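/- **Setting.** Let $L_0\subseteq L$ be first-order languages, $T$ an $L$-theory, and $T_0$ the reduct of $T$ to $L_0$, i.e. the set of $L_0$-sentences that follow from $T$. Structures are non-empty. For a structure $M$ and $A\subseteq M$, the algebraic closure of $A$ is the union of the finite $A$-definable subsets of $M$; write $\mathrm{acl}_0$ for algebraic closure in the sense of $L_0$, $\mathrm{acl}_T$ in the sense of $L$. A tuple $a$ is $\mathrm{acl}_0$-independent over $C$ if no $a_i$ lies in $\mathrm{acl}_0(C\cup\{a_j: j\ne i\})$. The triple $(T,T_0,L_0)$ is *suitable* if - $T$ is model complete; - $T_0$ is model complete, and $\mathrm{acl}_0(A)\models T_0$ for every infinite subset $A$ of a model of $T_0$; - in every model of $T_0$, $\mathrm{acl}_0$ is a modular pregeometry: it satisfies exchange, and any two closed sets $A,B$ are independent over $A\cap B$ (every subset of $A$ that is independent over $A\cap B$ is independent over $B$); - for every $L$-formula $\phi(x,y)$ there is an $L$-formula $\theta_\phi(y)$ such that for all $M\models T$ and $b$ in $M$: $M\models\theta_\phi(b)$ if and only if there are an elementary extension $N\succ M$ and a tuple $a$ in $N$ with $N\models\phi(a,b)$ and $a$ $\mathrm{acl}_0$-independent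 over $M$. Let $S$ be a new unary predicate and $L_S=L\cup\{S\}$. Let $T_S$ be the $L_S$-theory whose models are the pairs $(M,M_0)$ with $M\models T$ and $M_0=S(M)$ an $L_0$-substructure of $M$ that is a model of $T_0$. An $L_0$-formula $\tau(t,x^0,x^1,y)$, $t$ a single variable, is *algebraic in $t$* if there is $n$ such that in all models of $T_0$ and for all values of the other variables it has at most $n$ solutions $t$; it is *strict in $x^1$* if in all models of $T_0$, whenever $a^1$ is $\mathrm{acl}_0$-independent over $a^0b$, every solution of $\tau(t,a^0,a^1,b)$ lies in $\mathrm{acl}_0(a^0a^1b)\setminus\mathrm{acl}_0(a^0b)$. Let $TS$ be the theory axiomatised by $T_S$ together with the sentences $$\forall y\,\Bigl(\theta_\phi(y)\rightarrow \exists x\,\bigl(\phi(x,y)\wedge x^0\subseteq S\wedge\bigwedge_{i<k}\forall t\,(\tau_i(t,x,y)\rightarrow t\notin S)\bigr)\Bigr)$$ for all $L$-formulas $\phi(x,y)$ with $x=x^0x^1$ and all finite families of $L_0$-formulas $\tau_i(t,x,y)$ that are algebraic in $t$ and strict in $x^1$. For models $(M,M_0),(N,N_0)$ of $TS$ and $A\subseteq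 M$, $B\subseteq N$, a *$T$-elementary $L_S$-isomorphism* $f:\mathrm{acl}_T(A)\to\mathrm{acl}_T(B)$ is a bijection between the closures (computed in $M$ and $N$ respectively) such that $M\models\psi(c)\iff N\models\psi(f(c))$ for every $L$-formula $\psi$ (sentences included) and every finite tuple $c$ of $\mathrm{acl}_T(A)$, and $f(M_0\cap\mathrm{acl}_T(A))=N_0\cap\mathrm{acl}_T(B)$. **Proposition 1.10.** Let $(T,T_0,L_0)$ be a suitable triple. 1. Let $(M,M_0)$ and $(N,N_0)$ be models of $TS$ and $A$ a common subset of $M$ and $N$. Then $(M,M_0)$ and $(N,N_0)$ are elementarily equivalent over $A$ in $L_S$ if and only if there is a $T$-elementary $L_S$-isomorphism from $\mathrm{acl}_T(A)$ computed in $M$ to $\mathrm{acl}_T(A)$ computed in $N$ that fixes $A$ pointwise. 2. Let $A$ be a subset of a model of $TS$ and $a,b$ (possibly infinite) tuples of the same length in that model. Then $a$ and $b$ have the same $L_S$-type over $A$ if and only if there is a $T$-elementary $L_S$-isomorphism $f:\mathrm{acl}_T(Aa)\to\mathrm{acl}_T(Ab)$ that fixes $A$ pointwise and satisfies $f(a)=b$.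 3. The completions of $TS$ are given by the $T$-elementary $L_S$-isomorphism types of $(\mathrm{acl}_T(\emptyset),S(\mathrm{acl}_T(\emptyset)))$: the complete theories of the models of $TS$ are exactly the completions of $TS$, and two models of $TS$ have the same complete theory if and only if there is a $T$-elementary $L_S$-isomorphism between their sets $\mathrm{acl}_T(\emptyset)$. 4. For every subset $A$ of a model of $TS$, the algebraic closure of $A$ in the sense of $L_S$ equals $\mathrm{acl}_T(A)$. -/

import Mathlib

open FirstOrder FirstOrder.Language

universe u v w

namespace GenericExpansion

/-! ### Algebraic closure and the pregeometry notions -/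

section Closure

/-- The model-theoretic algebraic closure of a set `A` of parameters in an `L`-structure `M`:
the union of all finite `A`-definable subsets of `M`. -/
def acl (L : FirstOrder.Language.{u, v}) {M : Type w} [L.Structure M] (A : Set M) : Set M :=
  {x | ∃ D : Set M, A.Definable₁ L D ∧ D.Finite ∧ x ∈ D}

theorem subset_acl (L : FirstOrder.Language.{u, v}) {M : Type w} [L.Structure M] (A : Set M) :
    A ⊆ acl L A := by
  intro x hx
  refine ⟨{x}, ?_, Set.finite_singleton x, rfl⟩
  refine ⟨Term.equal (Term.var 0) (L.con (⟨x, hx⟩ : A)).term, ?_⟩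
  ext y
  simp [Formula.realize_equal]

/-- The algebraic closure computed in the reduct along `φ : L₀ →ᴸ L` of an `L`-structure. -/
def aclReduct {L₀ L : FirstOrder.Language.{u, v}} (φ : L₀ →ᴸ L) {M : Type w} [L.Structure M]
    (A : Set M) : Set M :=
  letI : L₀.Structure M := φ.reduct M
  acl L₀ A

variable {X : Type w}

/-- Steinitz exchange for a closure operator. -/
def Exchange (cl : Set X → Set X) : Prop :=
  ∀ (A : Set X) (a b : X), a ∈ cl (insert b A) → a ∉ cl A → b ∈ cl (insert a A)

/-- The tuple `a` is `cl`-independent over `C`: no entry lies in the closure of `C` together with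
the other entries (in particular the entries are distinct). -/
def IndepTuple (cl : Set X → Set X) {ι : Type*} (C : Set X) (a : ι → X) : Prop :=
  ∀ i, a i ∉ cl (C ∪ a '' {i}ᶜ)

/-- The set `I` is `cl`-independent over `C`. -/
def IndepSet (cl : Set X → Set X) (C I : Set X) : Prop :=
  ∀ x ∈ I, x ∉ cl (C ∪ (I \ {x}))

/-- The independence relation `A ⫝_C B` of a pregeometry: every subset of `A` which is independent
over `C` stays independent over `C ∪ B`. -/
def IndepRel (cl : Set X → Set X) (A C B : Set X) : Prop :=
  ∀ I ⊆ A, IndepSet cl C I → IndepSet cl (C ∪ B) I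

/-- Modularity: any two closed sets are independent over their intersection. -/
def Modular (cl : Set X → Set X) : Prop :=
  ∀ A B : Set X, cl A = A → cl B = B → IndepRel cl A (A ∩ B) B

end Closure

/-! ### The language with a predicate, the reduct, and the theory of pairs -/

/-- The symbols of the one-predicate language: a single unary relation symbol `S`. -/
inductive predRel : ℕ → Type
  | S : predRel 1

/-- The language whose only symbol is the unary predicate `S`. -/
def predLang : FirstOrder.Language.{0, 0} := ⟨fun _ => Empty, predRel⟩

/-- The symbol `S` of the one-predicate language. -/
abbrev predS : predLang.Relations 1 := predRel.S

/-- The expansion of `L` by the unary predicate `S`. -/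
abbrev LS (L : FirstOrder.Language.{u, v}) : FirstOrder.Language.{u, v} := L.sum predLang

/-- The symbol `S` in the expanded language. -/
abbrev symS (L : FirstOrder.Language.{u, v}) : (LS L).Relations 1 :=
  Sum.inr predS

/-- The interpretation `S(M)` of the predicate. -/
def pred (M : Type w) [predLang.Structure M] : Set M :=
  {x | Structure.RelMap predS ![x]}

section Theories

variable {L₀ L : FirstOrder.Language.{u, v}} (φ : L₀ →ᴸ L) (T : L.Theory)

/-- The reduct `T₀` of `T` to the sublanguage `L₀`: all `L₀`-sentences which are consequences
of `T`. -/
def reductTheory : L₀.Theory := {σ | T ⊨ᵇ φ.onSentence σ}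

/-- The embedding of `L₀` into the expansion of `L` by `S`. -/
abbrev toLS : L₀ →ᴸ LS L := (LHom.sumInl : L →ᴸ LS L).comp φ

/-- The relativization to `S` of an `L₀`-formula: quantifiers range over `S`. -/
def relativize {α : Type} : ∀ {n : ℕ}, L₀.BoundedFormula α n → (LS L).BoundedFormula α n
  | _, .falsum => .falsum
  | _, .equal t₁ t₂ => .equal ((toLS φ).onTerm t₁) ((toLS φ).onTerm t₂)
  | _, .rel R ts => .rel ((toLS φ).onRelation R) fun i => (toLS φ).onTerm (ts i)
  | _, .imp ψ₁ ψ₂ => (relativize ψ₁).imp (relativize ψ₂)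
  | n, .all ψ =>
      (((symS L).boundedFormula₁ (Term.var (Sum.inr (Fin.last n)))).imp (relativize ψ)).all

/-- The sentence saying that `S` is closed under the function symbol `f` of `L₀`. -/
noncomputable def closedUnder {n : ℕ} (f : L₀.Functions n) : (LS L).Sentence :=
  Formula.iAlls (α := Empty) (Fin n)
    (Formula.imp (Formula.iInf fun i : Fin n => (symS L).formula₁ (Term.var (Sum.inr i)))
      ((symS L).formula₁ (Term.func ((toLS φ).onFunction f) fun i => Term.var (Sum.inr i))))

/-- The theory `T_S` of pairs `(M, M₀)` with `M ⊨ T` and `M₀ = S(M)` an `L₀`-substructure of `M`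
which is a model of `T₀`. -/
def pairTheory : (LS L).Theory :=
  (LHom.sumInl : L →ᴸ LS L).onTheory T ∪
    {σ | ∃ (n : ℕ) (f : L₀.Functions n), σ = closedUnder φ f} ∪
    {σ | ∃ τ ∈ reductTheory φ T, σ = relativize φ τ}

end Theories

/-! ### Suitable triples and the theory `TS`

All structures live in `Type (max u v w)`, with `w` arbitrary. -/

section Suitable

/-- A theory is model complete if every embedding between models is elementary. -/
def IsModelComplete {L : FirstOrder.Language.{u, v}} (T : L.Theory) : Prop :=
  ∀ (M N : Type (max u v w)) [L.Structure M] [L.Structure N] [Nonempty M] [Nonempty N]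
    [M ⊨ T] [N ⊨ T] (f : M ↪[L] N), ∃ g : M ↪ₑ[L] N, (g : M → N) = f

variable {L₀ L : FirstOrder.Language.{u, v}} (φ : L₀ →ᴸ L) (T : L.Theory)

/-- The defining property of `θ_ψ(y)`: for `b ∈ M ⊨ T`, `M ⊨ θ_ψ(b)` if and only if `ψ(b, x)` has
a solution which is an `acl₀`-independent tuple over `M` in some elementary extension of `M`. The
variables of `ψ` are the parameters `y : Fin m` and the tuple `x` indexed by `X`. -/
def IsGenericWitness {m : ℕ} {X : Type} (ψ : L.Formula (Fin m ⊕ X)) (θ : L.Formula (Fin m)) :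
    Prop :=
  ∀ (M : Type (max u v w)) [L.Structure M] [Nonempty M] [M ⊨ T] (b : Fin m → M),
    θ.Realize b ↔
      ∃ (N : Type (max u v w)) (_ : L.Structure N) (e : M ↪ₑ[L] N) (a : X → N),
        ψ.Realize (Sum.elim (e ∘ b) a) ∧ IndepTuple (aclReduct φ) (Set.range e) a

/-- The triple `(T, T₀, L₀)`, with `T₀` the reduct of `T` to the sublanguage `φ : L₀ →ᴸ L`,
is suitable. -/
structure Suitable : Prop where
  injective : φ.Injective
  modelComplete : IsModelComplete.{u, v, w} T
  modelComplete_reduct : IsModelComplete.{u, v, w} (reductTheory φ T)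
  acl_models : ∀ (M : Type (max u v w)) [L₀.Structure M] [Nonempty M] [M ⊨ reductTheory φ T]
    (A : Set M), A.Infinite →
      ∃ K : L₀.Substructure M, (K : Set M) = acl L₀ A ∧ K ⊨ reductTheory φ T
  exchange : ∀ (M : Type (max u v w)) [L₀.Structure M] [Nonempty M] [M ⊨ reductTheory φ T],
    Exchange (acl L₀ : Set M → Set M)
  modular : ∀ (M : Type (max u v w)) [L₀.Structure M] [Nonempty M] [M ⊨ reductTheory φ T],
    Modular (acl L₀ : Set M → Set M)
  witness : ∀ (n m : ℕ) (ψ : L.Formula (Fin m ⊕ Fin n)),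
    ∃ θ : L.Formula (Fin m), IsGenericWitness.{u, v, w} φ T ψ θ

/-- The formula `τ(t, z)`, where `t` is the variable indexed by `Fin 1`, is algebraic in `t`: for some `k`,
in all models of `T₀` and for all `c` the formula `τ(t, c)` has at most `k` realizations. -/
def IsAlgebraicIn (T₀ : L₀.Theory) {V : Type} (τ : L₀.BoundedFormula V 1) : Prop :=
  ∃ k : ℕ, ∀ (M : Type (max u v w)) [L₀.Structure M] [Nonempty M] [M ⊨ T₀] (c : V → M),
    {t : M | τ.Realize c ![t]}.encard ≤ k

/-- The formula `τ(t, y, x⁰, x¹)` is strict in `x¹`: whenever `x¹` is an independent tuple over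
`y x⁰`, all realizations `t` lie in `acl₀(y, x⁰, x¹) \ acl₀(y, x⁰)`. -/
def IsStrictIn (T₀ : L₀.Theory) {m p q : ℕ}
    (τ : L₀.BoundedFormula (Fin m ⊕ (Fin p ⊕ Fin q)) 1) : Prop :=
  ∀ (M : Type (max u v w)) [L₀.Structure M] [Nonempty M] [M ⊨ T₀]
    (y : Fin m → M) (x₀ : Fin p → M) (x₁ : Fin q → M),
    IndepTuple (acl L₀) (Set.range y ∪ Set.range x₀) x₁ →
      ∀ t : M, τ.Realize (Sum.elim y (Sum.elim x₀ x₁)) ![t] →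
        t ∈ acl L₀ (Set.range y ∪ Set.range x₀ ∪ Set.range x₁) \
          acl L₀ (Set.range y ∪ Set.range x₀)

/-- The sentence
`∀ y (θ(y) → ∃ x⁰ x¹ (ψ(y, x⁰, x¹) ∧ x⁰ ⊆ S ∧ ⋀ i, ∀ t (τ i (t, y, x⁰, x¹) → t ∉ S)))`.
The variables are `y : Fin m`, `x⁰ : Fin p` and `x¹ : Fin q`. -/
noncomputable def genericAxiom {m p q k : ℕ} (ψ : L.Formula (Fin m ⊕ (Fin p ⊕ Fin q)))
    (θ : L.Formula (Fin m)) (τ : Fin k → L₀.BoundedFormula (Fin m ⊕ (Fin p ⊕ Fin q)) 1) :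
    (LS L).Sentence :=
  Formula.iAlls (α := Empty) (Fin m) <| Formula.relabel Sum.inr <|
    Formula.imp ((LHom.sumInl : L →ᴸ LS L).onFormula θ) <|
      Formula.iExs (Fin p ⊕ Fin q)
        ((LHom.sumInl : L →ᴸ LS L).onFormula ψ ⊓
          (Formula.iInf fun i : Fin p =>
            (symS L).formula₁ (Term.var (Sum.inr (Sum.inl i)))) ⊓
          (Formula.iInf fun i : Fin k =>
            BoundedFormula.all (((toLS φ).onBoundedFormula (τ i)).imp
              ((symS L).boundedFormula₁ (Term.var (Sum.inr 0))).not)))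

/-- The theory `TS`: the theory `T_S` of pairs together with all the axioms `genericAxiom ψ θ τ`
where `θ` is a formula `θ_ψ` and the `L₀`-formulas `τ i` are algebraic in `t` and strict
in `x¹`. -/
def genericTheory : (LS L).Theory :=
  pairTheory φ T ∪
    {σ | ∃ (m p q k : ℕ) (ψ : L.Formula (Fin m ⊕ (Fin p ⊕ Fin q))) (θ : L.Formula (Fin m))
      (τ : Fin k → L₀.BoundedFormula (Fin m ⊕ (Fin p ⊕ Fin q)) 1),
      IsGenericWitness.{u, v, w} φ T ψ θ ∧
      (∀ i, IsAlgebraicIn.{u, v, w} (reductTheory φ T) (τ i)) ∧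
      (∀ i, IsStrictIn.{u, v, w} (reductTheory φ T) (τ i)) ∧
      σ = genericAxiom φ ψ θ τ}

end Suitable

/-! ### Elementary equivalence over parameters and isomorphisms of algebraic closures -/

section Maps

/-- The structures `M` and `N` are elementarily equivalent over the parameters `A`, interpreted by
`i` in `M` and by `j` in `N`. For `M = N` this says that the tuples `i` and `j` have the same
type. -/
def EquivOver (L : FirstOrder.Language.{u, v}) {M N A : Type*} [L.Structure M] [L.Structure N]
    (i : A → M) (j : A → N) : Prop :=
  ∀ ψ : L.Formula A, ψ.Realize i ↔ ψ.Realize j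

/-- The bijection `f : acl_T(A) → acl_T(B)`, for `A ⊆ M` and `B ⊆ N`, is a `T`-elementary
`L_S`-isomorphism: it preserves and reflects all `L`-formulas, evaluated in `M` and `N`, and
maps `S(M) ∩ acl_T(A)` onto `S(N) ∩ acl_T(B)`. -/
structure IsElementaryLSIso (L : FirstOrder.Language.{u, v}) {M N : Type*} [L.Structure M] [L.Structure N]
    [predLang.Structure M] [predLang.Structure N] {A : Set M} {B : Set N}
    (f : acl L A ≃ acl L B) : Prop where
  elementary : ∀ (n : ℕ) (ψ : L.Formula (Fin n)) (c : Fin n → acl L A),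
    ψ.Realize (fun k => (c k : M)) ↔ ψ.Realize (fun k => (f (c k) : N))
  map_pred : (fun x => (f x : N)) '' {x | (x : M) ∈ pred M} = pred N ∩ acl L B

end Maps

end GenericExpansion

open GenericExpansion

/-!
The proof is a back-and-forth argument carried out by compactness. Elementary maps are handled as
pairs of families `i : α → M`, `j : α → N` that satisfy the same formulas (`EquivOver L i j`).

The crucial point is `Suitable.exists_extension`: a partial `L`-elementary map `i a ↦ j a` between
models `M` and `N` of `TS` that respects `S` and has an `acl_T`-closed domain extends to an
`L`-elementary embedding of `M`, respecting `S`, into an `L_S`-elementary extension of `N`, such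
that the image of `M` meets `N` only in the image of the given map. It is proved in two steps.

* In the language `L` there is an elementary amalgam `K` of `M` and `N` over the given map with
  `M ∩ N` as small as possible (`EquivOver.exists_amalgam`). By compactness this amounts to finding
  solutions of formulas that avoid a finite set. This is P. M. Neumann's lemma; the proof given here
  uses that a family of finite sets of bounded size has only finitely many transversals of minimal
  size (`finite_transversals`).
* Let `X = acl₀(S(M) ∪ S(N))` in `K`. By modularity, `X` meets `M` in `S(M)` and `N` in `S(N)`. The
  axioms of genericity now imply that the type of `K` over `N`, with `X` as the interpretation of
  `S`, is finitely satisfiable in `N` (`Suitable.exists_solution`), except for the requirement that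
  the elements of `acl₀(N ∪ X) \ X` lie outside `S`; this holds automatically, again by modularity
  (`Suitable.exists_extension_of_closed`). Model completeness of `T₀` enters through the fact that
  `S` is `acl₀`-closed.

Induction on formulas then shows that partial `L`-elementary maps with `acl_T`-closed domain that
respect `S` are `L_S`-elementary (`Suitable.realize_iff`): to treat a quantifier, extend the map to
all of `M`. This gives one direction of the first three assertions. For the converse one embeds the
two models into a common elementary extension over the parameters, where the algebraic closures have
the same image. For the last assertion, let `A` be `acl_T`-closed in `M` and extend the identity of
`A` to an embedding of `M` into an elementary extension that moves every point outside `A` out of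
`M`; a finite `A`-definable set contained in `M` is not moved, so it is contained in `A`.
-/

namespace GenericExpansion

universe x y z

/-! ### Algebraic closure through formulas in arbitrary parameters -/

section AlgebraicClosure

variable {L : FirstOrder.Language.{u, v}} {M : Type x} {N : Type y} [L.Structure M] [L.Structure N]

/-- The set of solutions `t` of a formula `χ(p, t)` at the parameters `p = v`; the last variable
is the one indexed by `Unit`. -/
def solutions {β : Type*} (χ : L.Formula (β ⊕ Unit)) (v : β → M) : Set M :=
  {t | χ.Realize (Sum.elim v fun _ => t)}

theorem encard_le_iff_forall_exists_eq {X : Type*} (s : Set X) (k : ℕ) :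
    s.encard ≤ k ↔
      ∀ t : Fin (k + 1) → X, (∀ i, t i ∈ s) → ∃ i j, i ≠ j ∧ t i = t j := by
  constructor
  · intro h t ht
    by_contra! hne
    have hinj : Function.Injective t := fun i j hij => by
      by_contra hij'
      exact hne i j hij' hij
    have h1 : (Set.range t).encard ≤ k :=
      (Set.encard_le_encard (Set.range_subset_iff.2 ht)).trans h
    rw [← Set.image_univ, hinj.encard_image, Set.encard_univ] at h1
    simp only [ENat.card_eq_coe_fintype_card, Fintype.card_fin] at h1
    norm_cast at h1
    omega
  · intro h
    by_contra hlt
    have h1 : ((k + 1 : ℕ) : ℕ∞) ≤ s.encard := by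
      push_cast
      exact Order.add_one_le_of_lt (not_le.1 hlt)
    obtain ⟨t, hts, htc⟩ := Set.exists_subset_encard_eq h1
    have htf : t.Finite := Set.finite_of_encard_eq_coe htc
    have hc : Nat.card t = k + 1 := by
      rw [Nat.card_coe_set_eq, Set.ncard_def, htc]; rfl
    have := htf.to_subtype
    let e := (Finite.equivFinOfCardEq hc).symm
    obtain ⟨i, j, hij, he⟩ := h (fun i => (e i : X)) fun i => hts (e i).2
    exact hij (e.injective (Subtype.ext he))

/-- The formula saying that `χ(p, t)` has at most `k` solutions `t`. -/
noncomputable def cardLe {β : Type*} (χ : L.Formula (β ⊕ Unit)) (k : ℕ) : L.Formula β :=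
  Formula.iAlls (Fin (k + 1))
    ((Formula.iInf fun i : Fin (k + 1) => χ.relabel (Sum.map id fun _ => i)).imp
      (Formula.iSup fun q : {q : Fin (k + 1) × Fin (k + 1) // q.1 ≠ q.2} =>
        Term.equal (Term.var (Sum.inr q.1.1)) (Term.var (Sum.inr q.1.2))))

theorem realize_cardLe {β : Type*} (χ : L.Formula (β ⊕ Unit)) (k : ℕ) (v : β → M) :
    (cardLe χ k).Realize v ↔ (solutions χ v).encard ≤ k := by
  rw [encard_le_iff_forall_exists_eq, cardLe, Formula.realize_iAlls]
  refine forall_congr' fun t => ?_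
  rw [Formula.realize_imp, Formula.realize_iInf, Formula.realize_iSup]
  refine imp_congr (forall_congr' fun i => ?_) ?_
  · rw [Formula.realize_relabel]
    refine iff_of_eq (congrArg χ.Realize ?_)
    ext (b | b) <;> rfl
  · simp [Formula.realize_equal]

/-- The formula `χ(p, t)` cut off to be false as soon as `χ(p, ·)` has more than `k` solutions.
It has at most `k` solutions for all parameters in all structures. -/
noncomputable def bounded {β : Type*} (χ : L.Formula (β ⊕ Unit)) (k : ℕ) : L.Formula (β ⊕ Unit) :=
  χ ⊓ (cardLe χ k).relabel Sum.inl

theorem mem_solutions_bounded {β : Type*} (χ : L.Formula (β ⊕ Unit)) (k : ℕ) (v : β → M) (t : M) :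
    t ∈ solutions (bounded χ k) v ↔ t ∈ solutions χ v ∧ (solutions χ v).encard ≤ k := by
  rw [← realize_cardLe]
  simp [solutions, bounded, Formula.realize_relabel]

theorem encard_solutions_bounded_le {β : Type*} (χ : L.Formula (β ⊕ Unit)) (k : ℕ) (v : β → M) :
    (solutions (bounded χ k) v).encard ≤ k := by
  by_cases h : (solutions χ v).encard ≤ k
  · exact (Set.encard_le_encard fun t ht => ((mem_solutions_bounded χ k v t).1 ht).1).trans h
  · have : solutions (bounded χ k) v = ∅ :=
      Set.eq_empty_of_forall_notMem fun t ht => h ((mem_solutions_bounded χ k v t).1 ht).2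
    simp [this]

theorem mem_acl_range_iff {β : Type*} {v : β → M} {t : M} :
    t ∈ acl L (Set.range v) ↔
      ∃ χ : L.Formula (β ⊕ Unit), (solutions χ v).Finite ∧ t ∈ solutions χ v := by
  constructor
  · rintro ⟨D, hD, hfin, ht⟩
    obtain ⟨ψ, hψ⟩ := Set.definable_iff_exists_formula_sum.1 hD
    have hsol : solutions (ψ.relabel (Sum.map (fun a : Set.range v => a.2.choose)
        (fun _ : Fin 1 => ()))) v = D := by
      ext s
      have h1 : (fun _ : Fin 1 => s) ∈ {x : Fin 1 → M | x 0 ∈ D} ↔ s ∈ D := Iff.rfl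
      rw [← h1]
      change _ ↔ (fun _ : Fin 1 => s) ∈ {x : Fin 1 → M | x 0 ∈ D}
      have h2 := Set.ext_iff.1 hψ (fun _ : Fin 1 => s)
      refine Iff.trans ?_ h2.symm
      change Formula.Realize _ _ ↔ Formula.Realize _ _
      rw [Formula.realize_relabel]
      refine iff_of_eq (congrArg ψ.Realize ?_)
      ext (b | b)
      · exact b.2.choose_spec
      · rfl
    exact ⟨_, hsol ▸ hfin, hsol ▸ ht⟩
  · rintro ⟨χ, hfin, ht⟩
    refine ⟨_, Set.definable_iff_exists_formula_sum.2
      ⟨χ.relabel (Sum.map (fun b => ⟨v b, b, rfl⟩) fun _ => (0 : Fin 1)), ?_⟩, hfin, ht⟩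
    ext s
    change χ.Realize _ ↔ Formula.Realize _ _
    rw [Formula.realize_relabel]
    refine iff_of_eq (congrArg χ.Realize ?_)
    ext (b | b) <;> rfl

/-- A uniform version of `mem_acl_range_iff`: the algebraic formula can be taken with boundedly
many solutions in all structures. -/
theorem exists_bounded_of_mem_acl {β : Type*} {v : β → M} {t : M} (h : t ∈ acl L (Set.range v)) :
    ∃ (χ : L.Formula (β ⊕ Unit)) (k : ℕ), t ∈ solutions (bounded χ k) v := by
  obtain ⟨χ, hfin, ht⟩ := mem_acl_range_iff.1 h
  refine ⟨χ, (solutions χ v).ncard, (mem_solutions_bounded _ _ _ _).2 ⟨ht, ?_⟩⟩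
  rw [hfin.cast_ncard_eq]

theorem solutions_bounded_subset_acl {β : Type*} (χ : L.Formula (β ⊕ Unit)) (k : ℕ) (v : β → M) :
    solutions (bounded χ k) v ⊆ acl L (Set.range v) := fun _ ht =>
  mem_acl_range_iff.2 ⟨_, Set.finite_of_encard_le_coe (encard_solutions_bounded_le χ k v), ht⟩

theorem acl_mono {A B : Set M} (h : A ⊆ B) : acl L A ⊆ acl L B :=
  fun _ ⟨D, hD, hfin, ht⟩ => ⟨D, hD.mono h, hfin, ht⟩

theorem exists_finset_mem_acl {A : Set M} {t : M} (h : t ∈ acl L A) :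
    ∃ F : Finset M, (F : Set M) ⊆ A ∧ t ∈ acl L (F : Set M) := by
  obtain ⟨D, hD, hfin, ht⟩ := h
  obtain ⟨F, hF, hFD⟩ := Set.definable_iff_finitely_definable.1 hD
  exact ⟨F, hF, D, hFD, hfin, ht⟩

theorem acl_acl (A : Set M) : acl L (acl L A) = acl L A := by
  refine Set.Subset.antisymm (fun t ht => ?_) (subset_acl L _)
  obtain ⟨F, hFA, htF⟩ := exists_finset_mem_acl ht
  have h1 : t ∈ acl L (Set.range fun b : F => (b : M)) := by
    rwa [Subtype.range_coe_subtype, Finset.setOfPred_mem]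
  obtain ⟨χ, k, hχ⟩ := exists_bounded_of_mem_acl h1
  have h2 : ∀ b : F, ∃ χ' : L.Formula (A ⊕ Unit),
      (solutions χ' ((↑) : A → M)).Finite ∧ (b : M) ∈ solutions χ' ((↑) : A → M) := fun b => by
    rw [← mem_acl_range_iff, Subtype.range_coe]
    exact hFA b.2
  choose χ' hfin hmem using h2
  rw [← Subtype.range_coe (s := A), mem_acl_range_iff]
  let ψ : L.Formula (A ⊕ Unit) := Formula.iExs F
    ((Formula.iInf fun b : F => (χ' b).relabel (Sum.elim (fun a => Sum.inl (Sum.inl a))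
        fun _ => Sum.inr b)) ⊓
      (bounded χ k).relabel (Sum.elim (fun b : F => Sum.inr b) fun _ => Sum.inl (Sum.inr ())))
  have hψ : solutions ψ ((↑) : A → M) =
      ⋃ y ∈ Set.pi Set.univ (fun b : F => solutions (χ' b) ((↑) : A → M)),
        solutions (bounded χ k) y := by
    ext s
    simp only [ψ, solutions, Set.mem_ofPred_eq, Formula.realize_iExs, Formula.realize_inf,
      Formula.realize_iInf, Formula.realize_relabel, Set.mem_iUnion, Set.mem_pi, Set.mem_univ,
      true_implies, exists_prop]
    refine exists_congr fun y => and_congr (forall_congr' fun b => ?_) ?_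
    · refine iff_of_eq (congrArg (χ' b).Realize ?_)
      ext (b | b) <;> rfl
    · refine iff_of_eq (congrArg (bounded χ k).Realize ?_)
      ext (b | b) <;> rfl
  refine ⟨ψ, ?_, ?_⟩
  · rw [hψ]
    exact (Set.Finite.pi hfin).biUnion fun y _ =>
      Set.finite_of_encard_le_coe (encard_solutions_bounded_le χ k y)
  · rw [hψ]
    exact Set.mem_biUnion (x := fun b : F => (b : M)) (fun b _ => hmem b) hχ

theorem acl_subset_of_subset_acl {A B : Set M} (h : A ⊆ acl L B) : acl L A ⊆ acl L B :=
  (acl_mono h).trans (acl_acl B).subset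

end AlgebraicClosure

/-! ### Partial elementary maps -/

section EquivOver

variable {L : FirstOrder.Language.{u, v}} {M : Type x} {N : Type y} [L.Structure M] [L.Structure N]

theorem EquivOver.symm {α : Type*} {i : α → M} {j : α → N} (h : EquivOver L i j) :
    EquivOver L j i := fun ψ => (h ψ).symm

theorem EquivOver.comp {α β : Type*} {i : α → M} {j : α → N} (h : EquivOver L i j) (g : β → α) :
    EquivOver L (i ∘ g) (j ∘ g) := fun ψ => by
  simpa [Formula.realize_relabel] using h (ψ.relabel g)

theorem EquivOver.eq_iff {α : Type*} {i : α → M} {j : α → N} (h : EquivOver L i j) (a b : α) :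
    i a = i b ↔ j a = j b := by
  simpa [Formula.realize_equal] using h (Term.equal (Term.var a) (Term.var b))

theorem EquivOver.injective {g : M → N} (h : EquivOver L id g) : Function.Injective g :=
  fun a b hab => (h.eq_iff a b).2 hab

theorem EquivOver.of_expansion {L' : FirstOrder.Language} (φ : L →ᴸ L') [L'.Structure M]
    [L'.Structure N] [φ.IsExpansionOn M] [φ.IsExpansionOn N] {α : Type*} {i : α → M} {j : α → N}
    (h : EquivOver L' i j) : EquivOver L i j := fun ψ => by
  simpa using h (φ.onFormula ψ)

theorem _root_.FirstOrder.Language.ElementaryEmbedding.equivOver (e : M ↪ₑ[L] N) :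
    EquivOver L id e := fun ψ => (e.map_formula ψ id).symm

/-- An elementary map as a bundled elementary embedding. -/
def EquivOver.toElementaryEmbedding {g : M → N} (h : EquivOver L id g) : M ↪ₑ[L] N where
  toFun := g
  map_formula' _ ψ x := ((h.comp x) ψ).symm

theorem EquivOver.mem_solutions_iff {α β : Type*} {i : α → M} {j : α → N} (h : EquivOver L i j)
    (χ : L.Formula (β ⊕ Unit)) (g : β → α) (a : α) :
    i a ∈ solutions χ (i ∘ g) ↔ j a ∈ solutions χ (j ∘ g) := by
  have := h (χ.relabel (Sum.elim g fun _ => a))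
  rw [Formula.realize_relabel, Formula.realize_relabel, Sum.comp_elim, Sum.comp_elim] at this
  exact this

theorem EquivOver.mem_acl_iff {α β : Type*} {i : α → M} {j : α → N} (h : EquivOver L i j)
    (g : β → α) (a : α) :
    i a ∈ acl L (Set.range (i ∘ g)) ↔ j a ∈ acl L (Set.range (j ∘ g)) := by
  constructor
  · intro h'
    obtain ⟨χ, k, hχ⟩ := exists_bounded_of_mem_acl h'
    exact solutions_bounded_subset_acl χ k _ ((h.mem_solutions_iff _ g a).1 hχ)
  · intro h'
    obtain ⟨χ, k, hχ⟩ := exists_bounded_of_mem_acl h'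
    exact solutions_bounded_subset_acl χ k _ ((h.mem_solutions_iff _ g a).2 hχ)

/-- If the domain of a partial elementary map is algebraically closed, then so is its image: an
algebraic formula over the image has as many solutions there as its preimage has in the domain. -/
theorem EquivOver.acl_range_eq {α : Type*} {i : α → M} {j : α → N} (h : EquivOver L i j)
    (hi : acl L (Set.range i) = Set.range i) : acl L (Set.range j) = Set.range j := by
  refine Set.Subset.antisymm (fun t ht => ?_) (subset_acl L _)
  obtain ⟨χ, k, hχ⟩ := exists_bounded_of_mem_acl ht
  have hfin : (solutions (bounded χ k) i).Finite :=
    Set.finite_of_encard_le_coe (encard_solutions_bounded_le χ k i)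
  have hsub : solutions (bounded χ k) i ⊆ i '' Set.univ := by
    rw [Set.image_univ, ← hi]
    exact solutions_bounded_subset_acl χ k i
  have := hfin.to_subtype
  choose c hc using fun b : solutions (bounded χ k) i => hsub b.2
  let ψ : L.Formula α := Formula.iAlls Unit
    ((bounded χ k).imp (Formula.iSup fun b : solutions (bounded χ k) i =>
      Term.equal (Term.var (Sum.inr ())) (Term.var (Sum.inl (c b)))))
  have hψ : ψ.Realize i := by
    simp only [ψ, Formula.realize_iAlls, Formula.realize_imp, Formula.realize_iSup,
      Formula.realize_equal, Term.realize_var, Sum.elim_inl, Sum.elim_inr]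
    exact fun t ht => ⟨⟨t (), ht⟩, (hc ⟨t (), ht⟩).2.symm⟩
  have hψ' := (h ψ).1 hψ
  simp only [ψ, Formula.realize_iAlls, Formula.realize_imp, Formula.realize_iSup,
    Formula.realize_equal, Term.realize_var, Sum.elim_inl, Sum.elim_inr] at hψ'
  obtain ⟨b, hb⟩ := hψ' (fun _ => t) hχ
  exact ⟨c b, hb.symm⟩

theorem EquivOver.acl_image {g : M → N} (h : EquivOver L id g) (A : Set M) :
    acl L (g '' A) = g '' acl L A := by
  refine Set.Subset.antisymm ?_ ?_
  · have h1 : EquivOver L ((↑) : acl L A → M) (g ∘ (↑)) := h.comp _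
    have h2 := h1.acl_range_eq (by rw [Subtype.range_coe, acl_acl])
    rw [Set.range_comp, Subtype.range_coe] at h2
    rw [← h2]
    exact acl_mono (Set.image_mono (subset_acl L A))
  · rintro _ ⟨t, ht, rfl⟩
    have := (h.mem_acl_iff ((↑) : A → M) t).1
    rw [Function.id_comp, Set.range_comp, Subtype.range_coe] at this
    exact this ht

theorem EquivOver.acl_range {g : M → N} (h : EquivOver L id g) :
    acl L (Set.range g) = Set.range g := by
  have := h.acl_image Set.univ
  rw [Set.image_univ] at this
  rw [this, ← Set.image_univ, Set.univ_subset_iff.1 (subset_acl L Set.univ)]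

open Classical in
/-- A formula in the variables `α ⊕ V`, rewritten with only finitely many variables from `V`. -/
noncomputable def restrictRight {α V : Type*} (ψ : L.Formula (α ⊕ V)) {s : Finset V}
    (hs : ψ.freeVarFinset.toRight ⊆ s) : L.Formula (α ⊕ s) :=
  BoundedFormula.restrictFreeVar ψ fun c => match c with
    | ⟨Sum.inl a, _⟩ => Sum.inl a
    | ⟨Sum.inr b, hb⟩ => Sum.inr ⟨b, hs (Finset.mem_toRight.2 hb)⟩

open Classical in
theorem realize_restrictRight {α V : Type*} (ψ : L.Formula (α ⊕ V)) {s : Finset V}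
    (hs : ψ.freeVarFinset.toRight ⊆ s) (a : α → M) (w : V → M) :
    (restrictRight ψ hs).Realize (Sum.elim a fun b => w b) ↔ ψ.Realize (Sum.elim a w) :=
  BoundedFormula.realize_restrictFreeVar _ fun c => by
    rcases c with ⟨c | c, hc⟩ <;> rfl

theorem exists_extend_finset {V : Type*} [Nonempty M] {s : Finset V} (w : s → M) :
    ∃ w' : V → M, (fun b : s => w' b) = w :=
  ⟨Function.extend (↑) w fun _ => Classical.arbitrary M, funext fun b =>
    Subtype.val_injective.extend_apply _ _ b⟩

/-- A partial elementary map `i a ↦ j a` allows one to transfer the existence of solutions of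
formulas; infinitely many unknowns are harmless as only finitely many occur. -/
theorem EquivOver.exists_realize [Nonempty N] {α V : Type*} {i : α → M} {j : α → N}
    (h : EquivOver L i j) (ψ : L.Formula (α ⊕ V)) (w : V → M) (hw : ψ.Realize (Sum.elim i w)) :
    ∃ w' : V → N, ψ.Realize (Sum.elim j w') := by
  classical
  obtain ⟨y, hy⟩ := Formula.realize_iExs.1 ((h (Formula.iExs _ (restrictRight ψ subset_rfl))).1
    (Formula.realize_iExs.2 ⟨_, (realize_restrictRight ψ subset_rfl i w).2 hw⟩))
  obtain ⟨w', rfl⟩ := exists_extend_finset y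
  exact ⟨w', (realize_restrictRight ψ subset_rfl j w').1 hy⟩

end EquivOver

/-! ### Solutions avoiding a finite set -/

section Neumann

/-- `Y` meets every member of the family `E` of (indexed) finite sets. -/
def IsTransversal {G X : Type*} (E : Set (G → X)) (Y : Finset X) : Prop :=
  ∀ e ∈ E, ∃ g, e g ∈ Y

/-- A family of finite sets of bounded size has only finitely many transversals of minimal size:
an element of the family that avoids a given part `P` of a transversal leaves finitely many choices
for a further element of the transversal. -/
theorem finite_transversals {G X : Type*} [Finite G] (E : Set (G → X)) (d : ℕ)
    (hmin : ∀ Y : Finset X, IsTransversal E Y → d ≤ Y.card) (P : Finset X) :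
    {Y : Finset X | P ⊆ Y ∧ Y.card ≤ d ∧ IsTransversal E Y}.Finite := by
  classical
  induction hk : d - P.card generalizing P with
  | zero =>
    refine (Set.finite_singleton P).subset fun Y ⟨hPY, hY, _⟩ => ?_
    exact (Finset.eq_of_subset_of_card_le hPY (by omega)).symm
  | succ k ih =>
    have hP : ¬ IsTransversal E P := fun h => by
      have := hmin P h
      omega
    simp only [IsTransversal, not_forall, not_exists] at hP
    obtain ⟨e, he, hne⟩ := hP
    refine (Set.finite_iUnion fun g => ih (insert (e g) P) ?_).subset fun Y ⟨hPY, hY, hT⟩ => ?_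
    · rw [Finset.card_insert_of_notMem (hne g)]
      omega
    · obtain ⟨g, hg⟩ := hT e he
      exact Set.mem_iUnion.2 ⟨g, Finset.insert_subset hg hPY, hY, hT⟩

variable {L : FirstOrder.Language.{u, v}} {M : Type x} {N : Type y} [L.Structure M] [L.Structure N]

/-- The formula in `(p, y)` saying that `{y k | k < d}` meets every solution `z` of `ψ(p, z)`. -/
noncomputable def transversalFormula {α G : Type*} [Finite G] (ψ : L.Formula (α ⊕ G)) (d : ℕ) :
    L.Formula (α ⊕ Fin d) :=
  Formula.iAlls G ((ψ.relabel (Sum.map Sum.inl id)).imp (Formula.iSup fun q : G × Fin d =>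
    Term.equal (Term.var (Sum.inr q.1)) (Term.var (Sum.inl (Sum.inr q.2)))))

theorem realize_transversalFormula {α G : Type*} [Finite G] (ψ : L.Formula (α ⊕ G)) (d : ℕ)
    (a : α → M) (y : Fin d → M) :
    (transversalFormula ψ d).Realize (Sum.elim a y) ↔
      ∀ z : G → M, ψ.Realize (Sum.elim a z) → ∃ g k, z g = y k := by
  rw [transversalFormula, Formula.realize_iAlls]
  refine forall_congr' fun z => ?_
  rw [Formula.realize_imp, Formula.realize_iSup, Formula.realize_relabel]
  refine imp_congr (iff_of_eq (congrArg ψ.Realize ?_)) ?_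
  · ext (b | b) <;> rfl
  · simp [Formula.realize_equal]

/-- Let `i a ↦ j a` be a partial elementary map. If `ψ(i, z)` has a solution none of whose entries
is algebraic over `i`, then `ψ(j, z)` has a solution avoiding a given finite set. Otherwise
`ψ(j, z)` has a finite transversal, hence so has `ψ(i, z)`; the union of its transversals of
minimal size is then a finite set definable over `i` that meets every solution. -/
theorem EquivOver.exists_realize_notMem {α G : Type*} [Finite G] {i : α → M} {j : α → N}
    (h : EquivOver L i j) (ψ : L.Formula (α ⊕ G)) (w : G → M) (hw : ψ.Realize (Sum.elim i w))
    (hacl : ∀ g, w g ∉ acl L (Set.range i)) (D : Finset N) :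
    ∃ w' : G → N, ψ.Realize (Sum.elim j w') ∧ ∀ g, w' g ∉ D := by
  classical
  by_contra! hD
  let E : Set (G → M) := {z | ψ.Realize (Sum.elim i z)}
  have hex : ∃ d, ∃ Y : Finset M, Y.card = d ∧ IsTransversal E Y := by
    have h1 : (Formula.iExs _ (transversalFormula ψ D.card)).Realize j := by
      refine Formula.realize_iExs.2 ⟨fun k => D.equivFin.symm k,
        (realize_transversalFormula ψ _ _ _).2 fun z hz => ?_⟩
      obtain ⟨g, hg⟩ := hD z hz
      exact ⟨g, D.equivFin ⟨z g, hg⟩, by simp⟩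
    obtain ⟨y, hy⟩ := Formula.realize_iExs.1 ((h _).2 h1)
    rw [realize_transversalFormula] at hy
    refine ⟨_, Finset.univ.image y, rfl, fun z hz => ?_⟩
    obtain ⟨g, k, hk⟩ := hy z hz
    exact ⟨g, Finset.mem_image.2 ⟨k, Finset.mem_univ _, hk.symm⟩⟩
  obtain ⟨Y, hYd, hY⟩ := Nat.find_spec hex
  set d := Nat.find hex
  have hmin : ∀ Y : Finset M, IsTransversal E Y → d ≤ Y.card := fun Y hY =>
    Nat.find_min' hex ⟨Y, rfl, hY⟩
  have hfin := finite_transversals E d hmin ∅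
  -- `χ` defines the union of the transversals of size `d`
  let χ : L.Formula (α ⊕ Unit) := Formula.iExs (Fin d)
    (((transversalFormula ψ d).relabel (Sum.map Sum.inl id)) ⊓ Formula.iSup fun k : Fin d =>
      Term.equal (Term.var (Sum.inr k)) (Term.var (Sum.inl (Sum.inr ()))))
  have hχ : ∀ t, t ∈ solutions χ i ↔ ∃ y : Fin d → M,
      (∀ z : G → M, ψ.Realize (Sum.elim i z) → ∃ g k, z g = y k) ∧ ∃ k, y k = t := fun t => by
    simp only [χ, solutions, Set.mem_ofPred_eq, Formula.realize_iExs, Formula.realize_inf,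
      Formula.realize_iSup, Formula.realize_relabel, Formula.realize_equal, Term.realize_var,
      Sum.elim_inl, Sum.elim_inr]
    refine exists_congr fun y => and_congr ?_ Iff.rfl
    rw [← realize_transversalFormula]
    refine iff_of_eq (congrArg _ ?_)
    ext (b | b) <;> rfl
  obtain ⟨g, hg⟩ := hY w hw
  refine hacl g (mem_acl_range_iff.2 ⟨χ, ?_, (hχ _).2 ?_⟩)
  · refine (hfin.biUnion fun Y _ => Y.finite_toSet).subset fun t ht => ?_
    obtain ⟨y, hy, k, rfl⟩ := (hχ t).1 ht
    refine Set.mem_biUnion (x := Finset.univ.image y) ⟨Finset.empty_subset _, ?_, fun z hz => ?_⟩ ?_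
    · exact Finset.card_image_le.trans (by simp)
    · obtain ⟨g, k, hk⟩ := hy z hz
      exact ⟨g, Finset.mem_image.2 ⟨k, Finset.mem_univ _, hk.symm⟩⟩
    · simp
  · let e := Y.equivFinOfCardEq hYd
    refine ⟨fun k => e.symm k, fun z hz => ?_, e ⟨w g, hg⟩, by simp⟩
    obtain ⟨g, hg⟩ := hY z hz
    exact ⟨g, e ⟨z g, hg⟩, by simp⟩

theorem EquivOver.exists_realize_notMem_of_finset [Nonempty N] {α V : Type*} {i : α → M} {j : α → N}
    (h : EquivOver L i j) (ψ : L.Formula (α ⊕ V)) (w : V → M) (hw : ψ.Realize (Sum.elim i w))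
    (hacl : ∀ b, w b ∉ acl L (Set.range i)) (E : Finset V) (D : Finset N) :
    ∃ w' : V → N, ψ.Realize (Sum.elim j w') ∧ ∀ b ∈ E, w' b ∉ D := by
  classical
  have hs : ψ.freeVarFinset.toRight ⊆ ψ.freeVarFinset.toRight ∪ E := Finset.subset_union_left
  obtain ⟨y, hy, hyD⟩ := h.exists_realize_notMem (restrictRight ψ hs) _
    ((realize_restrictRight ψ hs i w).2 hw) (fun b => hacl b) D
  obtain ⟨w', rfl⟩ := exists_extend_finset y
  exact ⟨w', (realize_restrictRight ψ hs j w').1 hy,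
    fun b hb => hyD ⟨b, Finset.mem_union_right _ hb⟩⟩

end Neumann

/-! ### Compactness and amalgamation -/

section Compactness

variable {L : FirstOrder.Language.{u, v}}

/-- Compactness: a finitely realized family of formulas with parameters in `N`, in arbitrarily many
unknowns, is realized in an elementary extension of `N`. -/
theorem exists_extension_realizing {N V : Type (max u v w)} [L.Structure N] [Nonempty N]
    {I : Type*} (Γ : I → L.Formula (N ⊕ V))
    (hfin : ∀ s : Finset I, ∃ b : V → N, ∀ k ∈ s, (Γ k).Realize (Sum.elim id b)) :
    ∃ (N' : Type (max u v w)) (_ : L.Structure N') (_ : Nonempty N') (e : N → N') (b : V → N'),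
      EquivOver L id e ∧ ∀ k, (Γ k).Realize (Sum.elim e b) := by
  classical
  let Γ' : I ⊕ {ψ : L.Formula N // ψ.Realize id} → L.Formula (N ⊕ V) :=
    Sum.elim Γ fun ψ => ψ.1.relabel Sum.inl
  have hsat : Theory.IsSatisfiable (⋃ k, {Formula.equivSentence (Γ' k)} : L[[N ⊕ V]].Theory) := by
    rw [Theory.isSatisfiable_iUnion_iff_isSatisfiable_iUnion_finset]
    intro s
    obtain ⟨b, hb⟩ := hfin s.toLeft
    let _ : (constantsOn (N ⊕ V)).Structure N := constantsOn.structure (Sum.elim id b)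
    have : N ⊨ (⋃ k ∈ s, {Formula.equivSentence (Γ' k)} : L[[N ⊕ V]].Theory) := by
      refine ⟨fun σ hσ => ?_⟩
      simp only [Set.mem_iUnion, Set.mem_singleton_iff, exists_prop] at hσ
      obtain ⟨k, hk, rfl⟩ := hσ
      refine (Formula.realize_equivSentence N _).2 ?_
      change (Γ' k).Realize (Sum.elim id b)
      rcases k with k | k
      · exact hb k (Finset.mem_toLeft.2 hk)
      · exact Formula.realize_relabel.2 k.2
    exact Theory.Model.isSatisfiable N
  obtain ⟨N'⟩ := hsat
  let _ : L.Structure N' := (L.lhomWithConstants (N ⊕ V)).reduct N'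
  have hΓ : ∀ k, (Γ' k).Realize fun c => (L.con c : N') := fun k =>
    (Formula.realize_equivSentence N' (Γ' k)).1
      (Theory.realize_sentence_of_mem (⋃ k, {Formula.equivSentence (Γ' k)} : L[[N ⊕ V]].Theory)
        (Set.mem_iUnion.2 ⟨k, Set.mem_singleton _⟩))
  have he : ∀ ψ : L.Formula N, ψ.Realize id → ψ.Realize fun n => (L.con (Sum.inl n : N ⊕ V) : N') :=
    fun ψ hψ => Formula.realize_relabel.1 (hΓ (Sum.inr ⟨ψ, hψ⟩))
  refine ⟨N', inferInstance, inferInstance, fun n => (L.con (Sum.inl n : N ⊕ V) : N'),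
    fun n => (L.con (Sum.inr n : N ⊕ V) : N'), fun ψ => ⟨he ψ, fun hψ => ?_⟩, fun k => ?_⟩
  · by_contra hne
    exact Formula.realize_not.1 (he ψ.not (Formula.realize_not.2 hne)) hψ
  · refine Eq.mp (congrArg (Γ k).Realize ?_) (hΓ (Sum.inl k))
    ext (b | b) <;> rfl

/-- Elementary amalgamation over an algebraically closed set: the two structures can be embedded
in such a way that they meet only in the common part. -/
theorem EquivOver.exists_amalgam {M N : Type (max u v w)} [L.Structure M] [L.Structure N]
    [Nonempty N] {α : Type*} {i : α → M} {j : α → N} (h : EquivOver L i j)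
    (hi : acl L (Set.range i) = Set.range i) :
    ∃ (K : Type (max u v w)) (_ : L.Structure K) (_ : Nonempty K) (e : N → K) (g : M → K),
      EquivOver L id e ∧ EquivOver L id g ∧ (∀ a, g (i a) = e (j a)) ∧
        ∀ m n, g m = e n → m ∈ Set.range i := by
  classical
  let V := {m : M // m ∉ Set.range i}
  have hex : ∀ m, ∃ c : α ⊕ V, Sum.elim i ((↑) : V → M) c = m := fun m => by
    by_cases hm : m ∈ Set.range i
    · exact ⟨Sum.inl hm.choose, hm.choose_spec⟩
    · exact ⟨Sum.inr ⟨m, hm⟩, rfl⟩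
  choose c hc using hex
  let Γ : {ψ : L.Formula M // ψ.Realize id} ⊕ (α ⊕ V × N) → L.Formula (N ⊕ M) :=
    Sum.elim (fun ψ => ψ.1.relabel Sum.inr) (Sum.elim
      (fun a => Term.equal (Term.var (Sum.inr (i a))) (Term.var (Sum.inl (j a))))
      fun q => (Term.equal (Term.var (Sum.inr q.1.1)) (Term.var (Sum.inl q.2))).not)
  obtain ⟨K, _, hK, e, g, he, hg⟩ := exists_extension_realizing Γ fun s => by
    let ψ : L.Formula (α ⊕ V) := Formula.iInf fun k : s.toLeft => k.1.1.relabel c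
    have hψ : ψ.Realize (Sum.elim i ((↑) : V → M)) := by
      refine Formula.realize_iInf.2 fun k => Formula.realize_relabel.2 ?_
      rw [show Sum.elim i ((↑) : V → M) ∘ c = id from funext hc]
      exact k.1.2
    obtain ⟨w', hw', hD⟩ := h.exists_realize_notMem_of_finset ψ _ hψ
      (fun b => by rw [hi]; exact b.2)
      (s.toRight.toRight.image Prod.fst) (s.toRight.toRight.image Prod.snd)
    refine ⟨Sum.elim j w' ∘ c, ?_⟩
    rintro (k | a | q) hk
    · have := Formula.realize_iInf.1 hw' ⟨k, Finset.mem_toLeft.2 hk⟩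
      rw [Formula.realize_relabel] at this
      exact Formula.realize_relabel.2 this
    · suffices Sum.elim j w' (c (i a)) = j a by simpa [Γ, Formula.realize_equal] using this
      have := hc (i a)
      rcases hca : c (i a) with a' | b <;> rw [hca] at this
      · exact (h.eq_iff _ _).1 this
      · exact absurd ⟨a, this.symm⟩ b.2
    · have hq : q ∈ s.toRight.toRight := Finset.mem_toRight.2 (Finset.mem_toRight.2 hk)
      have h1 := hD _ (Finset.mem_image_of_mem _ hq)
      have h2 : w' q.1 ≠ q.2 := fun h3 => h1 (h3 ▸ Finset.mem_image_of_mem _ hq)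
      suffices Sum.elim j w' (c q.1) ≠ q.2 by simpa [Γ, Formula.realize_equal] using this
      have h3 := hc q.1
      rcases hcq : c q.1 with a' | b
      · exact absurd ⟨a', by rwa [hcq] at h3⟩ q.1.2
      · rw [hcq] at h3
        rwa [show b = q.1 from Subtype.ext h3]
  have hg1 : ∀ ψ : L.Formula M, ψ.Realize id → ψ.Realize g := fun ψ hψ => by
    have := Formula.realize_relabel.1 (hg (Sum.inl ⟨ψ, hψ⟩))
    exact this
  refine ⟨K, inferInstance, hK, e, g, he, fun ψ => ⟨hg1 ψ, fun hψ => ?_⟩, fun a => ?_,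
    fun m n hmn => ?_⟩
  · by_contra hne
    exact Formula.realize_not.1 (hg1 ψ.not (Formula.realize_not.2 hne)) hψ
  · simpa [Γ, Formula.realize_equal] using hg (Sum.inr (Sum.inl a))
  · by_contra hm
    have := hg (Sum.inr (Sum.inr (⟨m, hm⟩, n)))
    simp [Γ, Formula.realize_equal, hmn] at this

/-- Elementary amalgamation over an arbitrary set of parameters. -/
theorem EquivOver.exists_joint_extension {M N : Type (max u v w)} [L.Structure M] [L.Structure N]
    [Nonempty N] {α : Type*} {i : α → M} {j : α → N} (h : EquivOver L i j) :
    ∃ (K : Type (max u v w)) (_ : L.Structure K) (e : N → K) (g : M → K),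
      EquivOver L id e ∧ EquivOver L id g ∧ ∀ a, g (i a) = e (j a) := by
  classical
  let Γ : {ψ : L.Formula (α ⊕ M) // ψ.Realize (Sum.elim i id)} → L.Formula (N ⊕ M) :=
    fun ψ => ψ.1.relabel (Sum.map j id)
  obtain ⟨K, _, _, e, g, he, hg⟩ := exists_extension_realizing Γ fun s => by
    obtain ⟨w', hw'⟩ := h.exists_realize (Formula.iInf fun k : s => k.1.1) id
      (Formula.realize_iInf.2 fun k => k.1.2)
    refine ⟨w', fun k hk => Formula.realize_relabel.2 ?_⟩
    rw [Sum.elim_comp_map]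
    exact Formula.realize_iInf.1 hw' ⟨k, hk⟩
  have hg' : ∀ ψ : L.Formula (α ⊕ M), ψ.Realize (Sum.elim i id) →
      ψ.Realize (Sum.elim (e ∘ j) g) := fun ψ hψ => by
    have := Formula.realize_relabel.1 (hg ⟨ψ, hψ⟩)
    rwa [Sum.elim_comp_map] at this
  have hg1 : ∀ ψ : L.Formula M, ψ.Realize id → ψ.Realize g := fun ψ hψ => by
    have := Formula.realize_relabel.1 (hg' (ψ.relabel Sum.inr) (Formula.realize_relabel.2 hψ))
    exact this
  refine ⟨K, inferInstance, e, g, he, fun ψ => ⟨hg1 ψ, fun hψ => ?_⟩, fun a => ?_⟩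
  · by_contra hne
    exact Formula.realize_not.1 (hg1 ψ.not (Formula.realize_not.2 hne)) hψ
  · simpa [Formula.realize_equal] using
      hg' (Term.equal (Term.var (Sum.inr (i a))) (Term.var (Sum.inl a))) (by
        simp [Formula.realize_equal])

end Compactness

/-! ### Modular pregeometries -/

section Pregeometry

variable {X : Type w}

/-- The operator `cl` is a closure operator of finite character. -/
structure IsFinitaryClosure (cl : Set X → Set X) : Prop where
  subset : ∀ A, A ⊆ cl A
  mono : ∀ {A B}, A ⊆ B → cl A ⊆ cl B
  idem : ∀ A, cl (cl A) = cl A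
  finitary : ∀ {A t}, t ∈ cl A → ∃ F : Finset X, (F : Set X) ⊆ A ∧ t ∈ cl (F : Set X)

variable {cl : Set X → Set X}

theorem IsFinitaryClosure.subset_of_subset (h : IsFinitaryClosure cl) {A B : Set X}
    (hAB : A ⊆ cl B) : cl A ⊆ cl B :=
  (h.mono hAB).trans (h.idem B).subset

theorem IndepSet.insert (hcl : IsFinitaryClosure cl) (hex : Exchange cl) {C I : Set X} {t : X}
    (hI : IndepSet cl C I) (ht : t ∉ cl (C ∪ I)) : IndepSet cl C (insert t I) := by
  intro y hy hmem
  by_cases hyt : y = t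
  · subst hyt
    refine ht (hcl.mono (Set.union_subset_union_right _ ?_) hmem)
    rintro z ⟨rfl | hz, hne⟩
    · exact absurd rfl hne
    · exact hz
  · have hyI : y ∈ I := hy.resolve_left hyt
    have h1 : C ∪ (Insert.insert t I \ {y}) ⊆ Insert.insert t (C ∪ (I \ {y})) := by
      rintro z (hz | ⟨rfl | hz, hne⟩)
      · exact Or.inr (Or.inl hz)
      · exact Or.inl rfl
      · exact Or.inr (Or.inr ⟨hz, hne⟩)
    refine ht (hcl.mono ?_ (hex _ _ _ (hcl.mono h1 hmem) (hI y hyI)))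
    rintro z (rfl | hz | hz)
    · exact Or.inr hyI
    · exact Or.inl hz
    · exact Or.inr hz.1

/-- An independent set can be extended to one that generates a given finite set. -/
theorem IndepSet.exists_extension (hcl : IsFinitaryClosure cl) (hex : Exchange cl) {C P : Set X}
    (hP : IndepSet cl C P) (F : Finset X) :
    ∃ J, P ⊆ J ∧ J ⊆ P ∪ F ∧ IndepSet cl C J ∧ (F : Set X) ⊆ cl (C ∪ J) := by
  classical
  induction F using Finset.induction_on with
  | empty => exact ⟨P, subset_rfl, Set.subset_union_left, hP, by simp⟩
  | insert a F _ ih =>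
    obtain ⟨J, hPJ, hJF, hJ, hF⟩ := ih
    rw [Finset.coe_insert]
    by_cases ha : a ∈ cl (C ∪ J)
    · exact ⟨J, hPJ, hJF.trans (Set.union_subset_union_right _ (Set.subset_insert _ _)), hJ,
        Set.insert_subset ha hF⟩
    · refine ⟨Insert.insert a J, hPJ.trans (Set.subset_insert _ _), ?_, hJ.insert hcl hex ha, ?_⟩
      · exact Set.insert_subset (Or.inr (Or.inl rfl))
          (hJF.trans (Set.union_subset_union_right _ (Set.subset_insert _ _)))
      · exact Set.insert_subset (hcl.subset _ (Or.inr (Or.inl rfl)))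
          (hF.trans (hcl.mono (Set.union_subset_union_right _ (Set.subset_insert _ _))))

theorem indepSet_empty (C : Set X) : IndepSet cl C ∅ := fun _ h => h.elim

theorem IndepSet.indepTuple {C I : Set X} (hI : IndepSet cl C I) {ι : Type*} {a : ι → X}
    (ha : Function.Injective a) (hr : Set.range a ⊆ I) (hcl : IsFinitaryClosure cl) :
    IndepTuple cl C a := by
  intro k hk
  refine hI (a k) (hr ⟨k, rfl⟩) (hcl.mono (Set.union_subset_union_right _ ?_) hk)
  rintro _ ⟨l, hl, rfl⟩
  exact ⟨hr ⟨l, rfl⟩, fun h => hl (ha h)⟩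

/-- The modular law for the lattice of closed sets, in the form `P ∩ (B ∨ C) = C` for
`P ∩ B ⊆ C ⊆ P`. -/
theorem Modular.inter_cl_union_subset (hmod : Modular cl) (hcl : IsFinitaryClosure cl)
    (hex : Exchange cl) {P B C : Set X} (hP : cl P = P) (hB : cl B = B) (hC : cl C = C)
    (hCP : C ⊆ P) (hPB : P ∩ B ⊆ C) : P ∩ cl (B ∪ C) ⊆ C := by
  classical
  rintro t ⟨htP, ht⟩
  by_contra htC
  obtain ⟨F, hF, htF⟩ := hcl.finitary ht
  obtain ⟨J, -, hJF, hJ, hFJ⟩ := (indepSet_empty (cl := cl) (P ∩ B)).exists_extension hcl hex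
    (F.filter (· ∈ C))
  have hJC : J ⊆ C := fun z hz => by
    have := hJF hz
    simp only [Set.empty_union, Finset.coe_filter] at this
    exact this.2
  have h1 : IndepSet cl (P ∩ B) (insert t J) := hJ.insert hcl hex fun h =>
    htC (hC ▸ hcl.mono (Set.union_subset hPB hJC) h)
  have h2 := hmod P B hP hB (insert t J) (Set.insert_subset htP (hJC.trans hCP)) h1 t
    (Set.mem_insert t J)
  refine h2 (hcl.subset_of_subset ?_ htF)
  intro z hz
  have hJ' : B ∪ J ⊆ P ∩ B ∪ B ∪ (insert t J \ {t}) := by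
    rintro y (hy | hy)
    · exact Or.inl (Or.inr hy)
    · refine Or.inr ⟨Or.inr hy, fun h => htC ?_⟩
      rw [Set.mem_singleton_iff] at h
      exact h ▸ hJC hy
  by_cases hzC : z ∈ C
  · refine hcl.mono (Set.Subset.trans ?_ hJ')
      (hFJ (Finset.mem_coe.2 (Finset.mem_filter.2 ⟨hz, hzC⟩)))
    exact Set.union_subset_union_left _ Set.inter_subset_right
  · exact hcl.subset _ (hJ' (Or.inl ((hF hz).resolve_right hzC)))

/-- If `t` depends on `D ∪ S` but not on `D`, then some element of `S` can be exchanged for `t`. -/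
theorem Exchange.exists_mem_cl_insert (hex : Exchange cl) (hcl : IsFinitaryClosure cl) {D : Set X}
    {t : X} (htD : t ∉ cl D) (S : Finset X) (ht : t ∈ cl (D ∪ S)) :
    ∃ q ∈ S, q ∈ cl (insert t (D ∪ ((S : Set X) \ {q}))) := by
  classical
  induction S using Finset.induction_on with
  | empty => exact absurd (by simpa using ht) htD
  | insert a S ha ih =>
    rw [Finset.coe_insert] at ht ⊢
    by_cases htS : t ∈ cl (D ∪ S)
    · obtain ⟨q, hq, hq'⟩ := ih htS
      refine ⟨q, Finset.mem_insert_of_mem hq, hcl.mono (Set.insert_subset_insert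
        (Set.union_subset_union_right _ (Set.sdiff_subset_sdiff_left (Set.subset_insert _ _)))) hq'⟩
    · refine ⟨a, Finset.mem_insert_self _ _, ?_⟩
      rw [Set.union_insert] at ht
      refine hcl.mono (Set.insert_subset_insert (Set.union_subset_union_right _ ?_))
        (hex _ _ _ ht htS)
      exact fun z hz => ⟨Or.inr hz, fun h => ha (by rw [Set.mem_singleton_iff] at h; exact h ▸ hz)⟩

end Pregeometry

theorem isFinitaryClosure_acl (L : FirstOrder.Language.{u, v}) (M : Type w) [L.Structure M] :
    IsFinitaryClosure (acl L : Set M → Set M) :=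
  ⟨subset_acl L, acl_mono, acl_acl, exists_finset_mem_acl⟩

/-! ### The reduct to the sublanguage -/

section Reduct

variable {L₀ L : FirstOrder.Language.{u, v}} (φ : L₀ →ᴸ L) {T : L.Theory}

theorem isFinitaryClosure_aclReduct (M : Type w) [L.Structure M] :
    IsFinitaryClosure (aclReduct φ : Set M → Set M) :=
  let _ : L₀.Structure M := φ.reduct M
  isFinitaryClosure_acl L₀ M

variable {φ}

theorem EquivOver.aclReduct_image {M : Type x} {N : Type x} [L.Structure M] [L.Structure N]
    {g : M → N} (h : EquivOver L id g) (A : Set M) :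
    aclReduct φ (g '' A) = g '' aclReduct φ A :=
  let _ : L₀.Structure M := φ.reduct M
  let _ : L₀.Structure N := φ.reduct N
  (h.of_expansion φ).acl_image A

theorem EquivOver.aclReduct_range {M : Type x} {N : Type x} [L.Structure M] [L.Structure N]
    {g : M → N} (h : EquivOver L id g) : aclReduct φ (Set.range g) = Set.range g :=
  let _ : L₀.Structure M := φ.reduct M
  let _ : L₀.Structure N := φ.reduct N
  (h.of_expansion φ).acl_range

theorem realize_reductTheory (M : Type x) [L₀.Structure M] [L.Structure M] [φ.IsExpansionOn M]
    [Nonempty M] [M ⊨ T] : M ⊨ reductTheory φ T :=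
  ⟨fun σ hσ => (LHom.realize_onSentence M φ σ).1
    (Theory.ModelsBoundedFormula.realize_sentence hσ M)⟩

theorem Suitable.exchange_aclReduct (hT : Suitable.{u, v, w} φ T) (M : Type (max u v w))
    [L.Structure M] [Nonempty M] [M ⊨ T] : Exchange (aclReduct φ : Set M → Set M) :=
  let _ : L₀.Structure M := φ.reduct M
  have := realize_reductTheory (φ := φ) (T := T) M
  hT.exchange M

theorem Suitable.modular_aclReduct (hT : Suitable.{u, v, w} φ T) (M : Type (max u v w))
    [L.Structure M] [Nonempty M] [M ⊨ T] : Modular (aclReduct φ : Set M → Set M) :=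
  let _ : L₀.Structure M := φ.reduct M
  have := realize_reductTheory (φ := φ) (T := T) M
  hT.modular M

end Reduct

/-! ### The predicate `S` in models of the theory of pairs -/

section Pairs

variable {L₀ L : FirstOrder.Language.{u, v}} {φ : L₀ →ᴸ L} {T : L.Theory}

theorem toLS_isExpansionOn (M : Type*) [L₀.Structure M] [L.Structure M] [predLang.Structure M]
    [φ.IsExpansionOn M] : (toLS φ).IsExpansionOn M where
  map_onFunction f v := φ.map_onFunction f v
  map_onRelation R v := φ.map_onRelation R v

theorem relMap_symS {M : Type*} [L.Structure M] [predLang.Structure M] (t : M) :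
    Structure.RelMap (symS L) ![t] ↔ t ∈ pred M := Iff.rfl

/-- The relativization of `ψ` to `S` means the same in `M` as `ψ` does in the substructure `S(M)`. -/
theorem realize_relativize {M : Type*} [L₀.Structure M] [L.Structure M] [predLang.Structure M]
    [φ.IsExpansionOn M] (K : L₀.Substructure M) (hK : (K : Set M) = pred M) {α : Type} {n : ℕ}
    (ψ : L₀.BoundedFormula α n) (v : α → K) (xs : Fin n → K) :
    (relativize φ ψ).Realize (fun a => (v a : M)) (fun k => (xs k : M)) ↔ ψ.Realize v xs := by
  have := toLS_isExpansionOn (φ := φ) M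
  have hterm : ∀ {n : ℕ} (t : L₀.Term (α ⊕ Fin n)) (xs : Fin n → K),
      ((toLS φ).onTerm t).realize (Sum.elim (fun a => (v a : M)) fun k => (xs k : M)) =
        ((t.realize (Sum.elim v xs) : K) : M) := fun t xs => by
    rw [LHom.realize_onTerm]
    have h1 : (Sum.elim (fun a => (v a : M)) fun k => (xs k : M)) =
        K.subtype ∘ Sum.elim v xs := by ext (b | b) <;> rfl
    rw [h1]
    exact HomClass.realize_term K.subtype
  induction ψ with
  | falsum => exact Iff.rfl
  | equal t₁ t₂ =>
    change Term.realize _ _ = Term.realize _ _ ↔ Term.realize _ _ = Term.realize _ _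
    rw [hterm, hterm]
    exact Subtype.coe_injective.eq_iff
  | rel R ts =>
    change Structure.RelMap _ _ ↔ Structure.RelMap _ _
    simp only [hterm]
    rw [LHom.map_onRelation]
    exact StrongHomClass.map_rel K.subtype R _
  | imp ψ₁ ψ₂ ih₁ ih₂ => exact imp_congr (ih₁ xs) (ih₂ xs)
  | all ψ ih =>
    have hsnoc : ∀ t : K, (Fin.snoc (fun k => (xs k : M)) (t : M) : Fin _ → M) =
        fun k => ((Fin.snoc xs t : Fin _ → K) k : M) := fun t => by
      ext k
      refine Fin.lastCases ?_ (fun k => ?_) k <;> simp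
    have hS : ∀ t : M, (((symS L).boundedFormula₁ (Term.var (Sum.inr (Fin.last _)))) :
        (LS L).BoundedFormula α _).Realize (fun a => (v a : M))
          (Fin.snoc (fun k => (xs k : M)) t) ↔ t ∈ pred M := fun t => by
      rw [BoundedFormula.realize_rel₁]
      simp only [Term.realize_var, Sum.elim_inr, Fin.snoc_last]
      exact relMap_symS t
    constructor
    · intro h t
      have h1 := h t ((hS t).2 (hK ▸ t.2))
      rw [hsnoc] at h1
      exact (ih _).1 h1
    · intro h t ht
      have ht' : t ∈ K := by
        have := (hS t).1 ht
        rwa [← hK] at this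
      change BoundedFormula.Realize _ _ (Fin.snoc (fun k => (xs k : M)) ((⟨t, ht'⟩ : K) : M))
      rw [hsnoc]
      exact (ih _).2 (h ⟨t, ht'⟩)

theorem realize_closedUnder_iff {M : Type*} [L₀.Structure M] [L.Structure M] [predLang.Structure M]
    [φ.IsExpansionOn M] {n : ℕ} (f : L₀.Functions n) :
    M ⊨ closedUnder φ f ↔
      ∀ t : Fin n → M, (∀ k, t k ∈ pred M) → Structure.funMap f t ∈ pred M := by
  have := toLS_isExpansionOn (φ := φ) M
  have hS : ∀ t : (LS L).Term (Empty ⊕ Fin n), ∀ s : Empty ⊕ Fin n → M,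
      Formula.Realize ((symS L).formula₁ t) s ↔ t.realize s ∈ pred M := fun t s => by
    rw [Formula.realize_rel₁, relMap_symS]
  rw [Sentence.Realize, closedUnder, Formula.realize_iAlls]
  refine forall_congr' fun t => ?_
  rw [Formula.realize_imp, Formula.realize_iInf, hS]
  refine imp_congr (forall_congr' fun k => ?_) (iff_of_eq (congrArg (· ∈ pred M) ?_))
  · rw [hS]
    rfl
  · rw [Term.realize_func, LHom.map_onFunction]
    rfl

theorem model_of_pairTheory (φ : L₀ →ᴸ L) (T : L.Theory) (M : Type*) [L.Structure M]
    [predLang.Structure M] [M ⊨ pairTheory φ T] : M ⊨ T :=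
  (LHom.onTheory_model (LHom.sumInl : L →ᴸ LS L) T).1
    ⟨fun _ h => Theory.realize_sentence_of_mem (pairTheory φ T) (Or.inl (Or.inl h))⟩

/-- In a model of the theory of pairs, `S` is the universe of an `L₀`-substructure that models
`T₀`, and it is not empty. -/
theorem exists_substructure_pred (φ : L₀ →ᴸ L) (T : L.Theory) (M : Type*) [L.Structure M]
    [predLang.Structure M] [M ⊨ pairTheory φ T] [L₀.Structure M] [φ.IsExpansionOn M] :
    ∃ K : L₀.Substructure M, (K : Set M) = pred M ∧ K ⊨ reductTheory φ T ∧ Nonempty K := by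
  let K : L₀.Substructure M :=
    { carrier := pred M
      fun_mem := fun {n} f t ht => (realize_closedUnder_iff (φ := φ) f).1
        (Theory.realize_sentence_of_mem (pairTheory φ T) (Or.inl (Or.inr ⟨n, f, rfl⟩))) t ht }
  have hmod : K ⊨ reductTheory φ T := ⟨fun σ hσ => by
    have h1 : M ⊨ relativize φ σ :=
      Theory.realize_sentence_of_mem (pairTheory φ T) (Or.inr ⟨σ, hσ, rfl⟩)
    have h2 := (realize_relativize (φ := φ) K rfl σ (Empty.elim) default).1
    rw [Sentence.Realize, Formula.Realize] at h1 ⊢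
    convert h2 (by convert h1 using 1) using 1⟩
  refine ⟨K, rfl, hmod, ?_⟩
  -- `T₀` contains the sentence `∃ t, ⊤`, as structures are non-empty
  have hne : (BoundedFormula.ex ⊤ : L₀.Sentence) ∈ reductTheory φ T := by
    intro M' v xs
    let _ : L₀.Structure M' := φ.reduct M'
    refine (LHom.realize_onBoundedFormula φ _).2 (BoundedFormula.realize_ex.2 ?_)
    exact ⟨Classical.arbitrary M', BoundedFormula.realize_top.2 trivial⟩
  -- the sentence holds in `K` even if `K` is not assumed to be non-empty
  obtain ⟨t, -⟩ := BoundedFormula.realize_ex.1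
    (Theory.realize_sentence_of_mem (M := K) (reductTheory φ T) hne)
  exact ⟨t⟩

theorem nonempty_of_pairTheory (φ : L₀ →ᴸ L) (T : L.Theory) (M : Type*) [L.Structure M]
    [predLang.Structure M] [M ⊨ pairTheory φ T] : Nonempty M := by
  let _ : L₀.Structure M := φ.reduct M
  obtain ⟨K, -, -, ⟨t⟩⟩ := exists_substructure_pred φ T M
  exact ⟨t⟩

/-- `S` is closed for `acl₀`: by model completeness of `T₀` it is an elementary substructure. -/
theorem Suitable.aclReduct_pred (hT : Suitable.{u, v, w} φ T) (M : Type (max u v w))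
    [L.Structure M] [predLang.Structure M] [M ⊨ pairTheory φ T] :
    aclReduct φ (pred M) = pred M := by
  let _ : L₀.Structure M := φ.reduct M
  have := nonempty_of_pairTheory φ T M
  have := model_of_pairTheory φ T M
  have := realize_reductTheory (φ := φ) (T := T) M
  obtain ⟨K, hK, _, _⟩ := exists_substructure_pred φ T M
  obtain ⟨e, he⟩ := hT.modelComplete_reduct K M K.subtype
  have h1 := e.equivOver.acl_range
  rw [he] at h1
  have h2 : Set.range K.subtype = pred M := by
    rw [← hK]
    exact Subtype.range_coe
  rwa [h2] at h1

end Pairs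

/-! ### The axioms of genericity -/

section Axioms

variable {L₀ L : FirstOrder.Language.{u, v}} {φ : L₀ →ᴸ L} {T : L.Theory}

instance pairTheory_model_of_genericTheory (M : Type*) [L.Structure M]
    [predLang.Structure M] [h : M ⊨ genericTheory.{u, v, w} φ T] : M ⊨ pairTheory φ T :=
  Theory.Model.mono h fun _ h => Or.inl h

theorem indepTuple_comp_equiv {X : Type*} {cl : Set X → Set X} {C : Set X} {ι κ : Type*}
    (e : ι ≃ κ) (a : κ → X) : IndepTuple cl C (a ∘ e) ↔ IndepTuple cl C a := by
  rw [IndepTuple, IndepTuple, ← e.forall_congr_right]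
  refine forall_congr' fun k => ?_
  have : (a ∘ e) '' {k}ᶜ = a '' {e k}ᶜ := by
    rw [Set.image_comp, Set.image_compl_eq e.bijective, Set.image_singleton]
  rw [this]
  rfl

theorem IsGenericWitness.of_relabel {m : ℕ} {X X' : Type} (e : X ≃ X')
    {ψ : L.Formula (Fin m ⊕ X)} {θ : L.Formula (Fin m)}
    (h : IsGenericWitness.{u, v, w} φ T (ψ.relabel (Sum.map id e)) θ) :
    IsGenericWitness.{u, v, w} φ T ψ θ := by
  intro M _ _ _ b
  rw [h M b]
  refine exists_congr fun N => exists_congr fun _ => exists_congr fun f => ?_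
  have key : ∀ a : X' → N, (ψ.relabel (Sum.map id e)).Realize (Sum.elim (f ∘ b) a) ↔
      ψ.Realize (Sum.elim (f ∘ b) (a ∘ e)) := fun a => by
    rw [Formula.realize_relabel, Sum.elim_comp_map, Function.comp_id]
  constructor
  · rintro ⟨a, ha, hi⟩
    exact ⟨a ∘ e, (key a).1 ha, (indepTuple_comp_equiv e a).2 hi⟩
  · rintro ⟨a, ha, hi⟩
    refine ⟨a ∘ e.symm, (key _).2 ?_, (indepTuple_comp_equiv e.symm a).2 hi⟩
    rwa [Function.comp_assoc, e.symm_comp_self, Function.comp_id]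

theorem realize_genericAxiom {m p q k : ℕ} {ψ : L.Formula (Fin m ⊕ (Fin p ⊕ Fin q))}
    {θ : L.Formula (Fin m)} {τ : Fin k → L₀.BoundedFormula (Fin m ⊕ (Fin p ⊕ Fin q)) 1}
    {M : Type*} [L₀.Structure M] [L.Structure M] [predLang.Structure M] [φ.IsExpansionOn M] :
    M ⊨ genericAxiom φ ψ θ τ ↔ ∀ b : Fin m → M, θ.Realize b → ∃ x : Fin p ⊕ Fin q → M,
      ψ.Realize (Sum.elim b x) ∧ (∀ i, x (Sum.inl i) ∈ pred M) ∧
        ∀ i t, (τ i).Realize (Sum.elim b x) ![t] → t ∉ pred M := by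
  have := toLS_isExpansionOn (φ := φ) M
  rw [Sentence.Realize, genericAxiom, Formula.realize_iAlls]
  refine forall_congr' fun b => ?_
  rw [Formula.realize_relabel, Formula.realize_imp, LHom.realize_onFormula, Formula.realize_iExs]
  refine imp_congr Iff.rfl (exists_congr fun x => ?_)
  rw [Formula.realize_inf, Formula.realize_inf, LHom.realize_onFormula, Formula.realize_iInf,
    Formula.realize_iInf, and_assoc]
  refine and_congr Iff.rfl (and_congr (forall_congr' fun i => ?_) (forall_congr' fun i => ?_))
  · rw [Formula.realize_rel₁, relMap_symS]
    rfl
  · rw [Formula.Realize, BoundedFormula.realize_all]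
    refine forall_congr' fun t => ?_
    rw [BoundedFormula.realize_imp, BoundedFormula.realize_not, LHom.realize_onBoundedFormula,
      BoundedFormula.realize_rel₁, relMap_symS]
    have h1 : (Fin.snoc default t : Fin 1 → M) = ![t] := by
      ext k
      fin_cases k
      rfl
    rw [h1]
    exact Iff.rfl

/-- In a model `N` of `TS`, a formula over `N` that has an `acl₀`-independent solution over `N` in
some elementary extension has a solution as described by the axioms of genericity. -/
theorem Suitable.exists_generic_solution (hT : Suitable.{u, v, w} φ T) {N N₁ : Type (max u v w)}
    [L₀.Structure N] [L.Structure N] [predLang.Structure N] [φ.IsExpansionOn N] [L.Structure N₁]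
    [N ⊨ genericTheory.{u, v, w} φ T]
    {e : N → N₁} (he : EquivOver L id e) {m p q k : ℕ} (ψ : L.Formula (Fin m ⊕ (Fin p ⊕ Fin q)))
    (τ : Fin k → L₀.BoundedFormula (Fin m ⊕ (Fin p ⊕ Fin q)) 1)
    (halg : ∀ i, IsAlgebraicIn.{u, v, w} (reductTheory φ T) (τ i))
    (hstrict : ∀ i, IsStrictIn.{u, v, w} (reductTheory φ T) (τ i))
    (b : Fin m → N) (a : Fin p ⊕ Fin q → N₁) (ha : ψ.Realize (Sum.elim (e ∘ b) a))
    (hind : IndepTuple (aclReduct φ) (Set.range e) a) :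
    ∃ x : Fin p ⊕ Fin q → N,
      ψ.Realize (Sum.elim b x) ∧ (∀ i, x (Sum.inl i) ∈ pred N) ∧
        ∀ i t, (τ i).Realize (Sum.elim b x) ![t] → t ∉ pred N := by
  have := nonempty_of_pairTheory φ T N
  have := model_of_pairTheory φ T N
  obtain ⟨θ, hθ⟩ := hT.witness (p + q) m (ψ.relabel (Sum.map id finSumFinEquiv))
  have hθ' := hθ.of_relabel
  have hax : N ⊨ genericAxiom φ ψ θ τ := Theory.realize_sentence_of_mem
    (genericTheory.{u, v, w} φ T) (Or.inr ⟨m, p, q, k, ψ, θ, τ, hθ', halg, hstrict, rfl⟩)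
  exact realize_genericAxiom.1 hax b ((hθ' N b).2 ⟨N₁, inferInstance, he.toElementaryEmbedding, a,
    ha, hind⟩)

/-- The instance of the axioms of genericity for formulas with variables indexed by arbitrary
finite types. -/
theorem Suitable.exists_generic_solution_of_finite (hT : Suitable.{u, v, w} φ T)
    {N N₁ : Type (max u v w)} [L₀.Structure N] [L.Structure N] [predLang.Structure N]
    [φ.IsExpansionOn N] [L.Structure N₁] [N ⊨ genericTheory.{u, v, w} φ T] {e : N → N₁}
    (he : EquivOver L id e) {β P Q K : Type*} [Finite β] [Finite P] [Finite Q] [Finite K]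
    (ψ : L.Formula (β ⊕ (P ⊕ Q))) (τ : K → L₀.Formula ((β ⊕ (P ⊕ Q)) ⊕ Unit))
    (halg : ∀ i, ∃ k : ℕ, ∀ (M : Type (max u v w)) [L₀.Structure M] (c : β ⊕ (P ⊕ Q) → M),
      (solutions (τ i) c).encard ≤ k)
    (hstrict : ∀ i, ∀ (M : Type (max u v w)) [L₀.Structure M] [Nonempty M] [M ⊨ reductTheory φ T]
      (y : β → M) (x₀ : P → M) (x₁ : Q → M),
      IndepTuple (acl L₀) (Set.range y ∪ Set.range x₀) x₁ →
        solutions (τ i) (Sum.elim y (Sum.elim x₀ x₁)) ⊆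
          acl L₀ (Set.range y ∪ Set.range x₀ ∪ Set.range x₁) \
            acl L₀ (Set.range y ∪ Set.range x₀))
    (b : β → N) (a : P ⊕ Q → N₁) (ha : ψ.Realize (Sum.elim (e ∘ b) a))
    (hind : IndepTuple (aclReduct φ) (Set.range e) a) :
    ∃ x : P ⊕ Q → N, ψ.Realize (Sum.elim b x) ∧ (∀ i, x (Sum.inl i) ∈ pred N) ∧
      ∀ i, ∀ t ∈ solutions (τ i) (Sum.elim b x), t ∉ pred N := by
  obtain ⟨m, ⟨eβ⟩⟩ := Finite.exists_equiv_fin β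
  obtain ⟨p, ⟨eP⟩⟩ := Finite.exists_equiv_fin P
  obtain ⟨q, ⟨eQ⟩⟩ := Finite.exists_equiv_fin Q
  obtain ⟨k, ⟨eK⟩⟩ := Finite.exists_equiv_fin K
  let E : β ⊕ (P ⊕ Q) ≃ Fin m ⊕ (Fin p ⊕ Fin q) := Equiv.sumCongr eβ (Equiv.sumCongr eP eQ)
  let g : (β ⊕ (P ⊕ Q)) ⊕ Unit → (Fin m ⊕ (Fin p ⊕ Fin q)) ⊕ Fin 1 := Sum.map E fun _ => 0
  let σ : Fin k → L₀.BoundedFormula (Fin m ⊕ (Fin p ⊕ Fin q)) 1 := fun i =>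
    BoundedFormula.relabel (n := 1) (k := 0) g (τ (eK.symm i))
  have hσ : ∀ i {M : Type (max u v w)} [L₀.Structure M] (c : Fin m ⊕ (Fin p ⊕ Fin q) → M) (t : M),
      (σ i).Realize c ![t] ↔ t ∈ solutions (τ (eK.symm i)) (c ∘ E) := fun i M _ c t => by
    refine (BoundedFormula.realize_relabel (n := 0)).trans ?_
    change _ ↔ BoundedFormula.Realize _ _ _
    refine iff_of_eq (congrArg₂ (BoundedFormula.Realize (τ (eK.symm i))) ?_ ?_)
    · ext (z | z) <;> rfl
    · exact Subsingleton.elim _ _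
  have hcomp : ∀ {M : Type (max u v w)} (y : Fin m → M) (x : Fin p ⊕ Fin q → M),
      Sum.elim y x ∘ E = Sum.elim (y ∘ eβ) (x ∘ Equiv.sumCongr eP eQ) := fun y x => by
    ext (z | z) <;> rfl
  have hσalg : ∀ i, IsAlgebraicIn.{u, v, w} (reductTheory φ T) (σ i) := fun i => by
    obtain ⟨n, hn⟩ := halg (eK.symm i)
    refine ⟨n, fun M _ _ _ c => (Set.encard_le_encard fun t ht => ?_).trans (hn M (c ∘ E))⟩
    exact (hσ i c t).1 ht
  have hσstrict : ∀ i, IsStrictIn.{u, v, w} (reductTheory φ T) (σ i) := by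
    intro i M _ _ _ y x₀ x₁ h t ht
    have h' := hstrict (eK.symm i) M (y ∘ eβ) (x₀ ∘ eP) (x₁ ∘ eQ)
    simp only [EquivLike.range_comp] at h'
    refine h' ((indepTuple_comp_equiv eQ x₁).2 h) ?_
    have h1 := (hσ i _ t).1 ht
    rw [hcomp] at h1
    convert h1 using 2
    ext (z | z | z) <;> rfl
  have ha' : (ψ.relabel E).Realize
      (Sum.elim (e ∘ b ∘ eβ.symm) (a ∘ (Equiv.sumCongr eP eQ).symm)) := by
    rw [Formula.realize_relabel]
    refine Eq.mp (congrArg ψ.Realize ?_) ha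
    ext (z | z)
    · simp [E]
    · exact congrArg a ((Equiv.sumCongr eP eQ).symm_apply_apply z).symm
  obtain ⟨x, hx, hxS, hxτ⟩ := hT.exists_generic_solution he (ψ.relabel E) σ hσalg hσstrict
    (b ∘ eβ.symm) (a ∘ (Equiv.sumCongr eP eQ).symm) ha' ((indepTuple_comp_equiv _ _).2 hind)
  have hbx : Sum.elim (b ∘ eβ.symm) x ∘ E = Sum.elim b (x ∘ Equiv.sumCongr eP eQ) := by
    rw [hcomp, Function.comp_assoc, eβ.symm_comp_self, Function.comp_id]
  refine ⟨x ∘ Equiv.sumCongr eP eQ, ?_, fun i => hxS (eP i), fun i t ht => hxτ (eK i) t ?_⟩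
  · rwa [Formula.realize_relabel, hbx] at hx
  · rwa [hσ, hbx, eK.symm_apply_apply]

end Axioms

/-! ### Solutions in a given model of `TS` -/

section StrictFormula

theorem range_tuple_insert {β P Q : Type*} {q : Q} {M : Type*} (y : β → M) (x₀ : P → M)
    (x₁ : Q → M) (t : M) :
    Set.range (Sum.elim (Sum.elim (Sum.elim y x₀) fun r : ({q}ᶜ : Set Q) => x₁ r)
      fun _ : Unit => t) = insert t (Set.range y ∪ Set.range x₀ ∪ x₁ '' {q}ᶜ) := by
  rw [Set.Sum.elim_range, Set.Sum.elim_range, Set.Sum.elim_range, Set.range_const,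
    Set.union_singleton, Set.image_eq_range]

/-- If `t` is algebraic over a tuple `y x₀ x₁` and some entry of `x₁` is algebraic over `t` and the
rest of the tuple, then this is witnessed by a formula `τ(t, y, x₀, x₁)` which is algebraic in `t`
and strict in `x₁`. -/
theorem exists_strict_formula {L₀ : FirstOrder.Language.{u, v}} {N : Type x} [L₀.Structure N]
    {β P Q : Type*} (y : β → N) (x₀ : P → N) (x₁ : Q → N) (t : N) (q : Q)
    (ht : t ∈ acl L₀ (Set.range y ∪ Set.range x₀ ∪ Set.range x₁))
    (hq : x₁ q ∈ acl L₀ (insert t (Set.range y ∪ Set.range x₀ ∪ x₁ '' {q}ᶜ))) :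
    ∃ τ : L₀.Formula ((β ⊕ (P ⊕ Q)) ⊕ Unit), t ∈ solutions τ (Sum.elim y (Sum.elim x₀ x₁)) ∧
      (∃ k : ℕ, ∀ (M : Type z) [L₀.Structure M] (c : β ⊕ (P ⊕ Q) → M),
        (solutions τ c).encard ≤ k) ∧
      ∀ (M : Type z) [L₀.Structure M] (y : β → M) (x₀ : P → M) (x₁ : Q → M),
        IndepTuple (acl L₀) (Set.range y ∪ Set.range x₀) x₁ →
          solutions τ (Sum.elim y (Sum.elim x₀ x₁)) ⊆
            acl L₀ (Set.range y ∪ Set.range x₀ ∪ Set.range x₁) \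
              acl L₀ (Set.range y ∪ Set.range x₀) := by
  have hrange : Set.range (Sum.elim y (Sum.elim x₀ x₁)) =
      Set.range y ∪ Set.range x₀ ∪ Set.range x₁ := by
    rw [Set.Sum.elim_range, Set.Sum.elim_range, Set.union_assoc]
  rw [← hrange] at ht
  rw [← range_tuple_insert] at hq
  obtain ⟨χ₁, k₁, h₁⟩ := exists_bounded_of_mem_acl ht
  obtain ⟨χ₂, k₂, h₂⟩ := exists_bounded_of_mem_acl hq
  -- `χ₂` has the variables `y`, `x₀`, the entries of `x₁` other than `q`, and `t` as parameters,
  -- and its last variable stands for `x₁ q`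
  let r : (((β ⊕ P) ⊕ ({q}ᶜ : Set Q)) ⊕ Unit) ⊕ Unit → (β ⊕ (P ⊕ Q)) ⊕ Unit :=
    Sum.elim (Sum.elim (Sum.elim (Sum.elim (fun b => .inl (.inl b)) fun p => .inl (.inr (.inl p)))
      fun c => .inl (.inr (.inr c))) fun _ => .inr ()) fun _ => .inl (.inr (.inr q))
  let τ : L₀.Formula ((β ⊕ (P ⊕ Q)) ⊕ Unit) := bounded χ₁ k₁ ⊓ (bounded χ₂ k₂).relabel r
  have hr : ∀ {M : Type z} (y : β → M) (x₀ : P → M) (x₁ : Q → M) (t : M),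
      Sum.elim (Sum.elim y (Sum.elim x₀ x₁)) (fun _ => t) ∘ r =
        Sum.elim (Sum.elim (Sum.elim (Sum.elim y x₀) fun r : ({q}ᶜ : Set Q) => x₁ r)
          fun _ : Unit => t) fun _ => x₁ q := fun y x₀ x₁ t => by
    ext ((((b | b) | b) | b) | b) <;> rfl
  refine ⟨τ, Formula.realize_inf.2 ⟨h₁, Formula.realize_relabel.2 ?_⟩, ⟨k₁, fun M _ c => ?_⟩,
    fun M _ y x₀ x₁ hind t ht => ?_⟩
  · refine Eq.mp (congrArg (bounded χ₂ k₂).Realize ?_) h₂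
    ext ((((b | b) | b) | b) | b) <;> rfl
  · refine (Set.encard_le_encard fun t ht => ?_).trans (encard_solutions_bounded_le χ₁ k₁ c)
    exact (Formula.realize_inf.1 ht).1
  · obtain ⟨h₁, h₂⟩ := Formula.realize_inf.1 ht
    rw [Formula.realize_relabel, hr] at h₂
    refine ⟨?_, fun hmem => hind q ?_⟩
    · have := solutions_bounded_subset_acl χ₁ k₁ _ h₁
      rwa [Set.Sum.elim_range, Set.Sum.elim_range, ← Set.union_assoc] at this
    -- if `t` were algebraic over `y x₀`, then `x₁ q` would be so over `y x₀` and the rest of `x₁`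
    · have := solutions_bounded_subset_acl χ₂ k₂ _ h₂
      rw [range_tuple_insert] at this
      refine acl_subset_of_subset_acl (Set.insert_subset ?_ (subset_acl _ _)) this
      exact acl_mono Set.subset_union_left hmem

end StrictFormula

section Core

variable {L₀ L : FirstOrder.Language.{u, v}} {φ : L₀ →ᴸ L} {T : L.Theory}

theorem IsFinitaryClosure.exists_finset_image {X Y : Type*} {cl : Set X → Set X}
    (hcl : IsFinitaryClosure cl) {e : Y → X} {A : Set Y} {R : Set X} {t : X}
    (ht : t ∈ cl (e '' A ∪ R)) : ∃ F : Finset Y, (F : Set Y) ⊆ A ∧ t ∈ cl (e '' F ∪ R) := by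
  classical
  obtain ⟨F, hF, htF⟩ := hcl.finitary ht
  have h1 : ((F.filter (· ∈ e '' A) : Finset X) : Set X) ⊆ e '' A := by
    intro z hz
    exact (Finset.mem_filter.1 (Finset.mem_coe.1 hz)).2
  obtain ⟨F', hF', hF''⟩ := Finset.subset_set_image_iff.1 h1
  refine ⟨F', hF', hcl.mono (fun z hz => ?_) htF⟩
  by_cases hzA : z ∈ e '' A
  · have : z ∈ F'.image e := by
      rw [hF'']
      exact Finset.mem_filter.2 ⟨hz, hzA⟩
    rw [← Finset.coe_image]
    exact Or.inl this
  · exact Or.inr ((hF hz).resolve_left hzA)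

theorem EquivOver.realize_theory {M N : Type*} [L.Structure M] [L.Structure N] {T : L.Theory}
    {α : Type*} {i : α → M} {j : α → N} (h : EquivOver L i j) [hM : M ⊨ T] : N ⊨ T :=
  ⟨fun σ hσ => by
    have h1 := h (Formula.relabel Empty.elim σ)
    rw [Formula.realize_relabel, Formula.realize_relabel] at h1
    have h2 := Theory.realize_sentence_of_mem (M := M) T hσ
    rw [Sentence.Realize] at h2 ⊢
    convert h1.1 (by convert h2)⟩

/-- Let `N` be a model of `TS` and `N₁` an `L`-elementary extension, and
let `X ⊆ N₁` be an `acl₀`-closed set with `X ∩ N = S(N)`. Then formulas satisfied in `N₁` by a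
finite tuple `w` can be satisfied in `N` such that entries in `X` become elements of `S`, and
entries outside `acl₀(N ∪ X)` become elements outside `S`. To see it, take `acl₀`-bases `P ⊆ Q` over `N` of
the entries in `X` and of all entries. An entry in `X` is algebraic over `S(N) ∪ P`, by modularity,
and an entry outside `acl₀(N ∪ X)` satisfies over `N ∪ Q` a formula that is strict in `Q \ P`. The
axioms apply to the part `P` of `S` and the remaining part `Q \ P`. -/
theorem Suitable.exists_solution (hT : Suitable.{u, v, w} φ T) {N N₁ : Type (max u v w)}
    [L.Structure N] [predLang.Structure N] [L.Structure N₁] [N ⊨ genericTheory.{u, v, w} φ T]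
    {e : N → N₁} (he : EquivOver L id e) {X : Set N₁} (hX : aclReduct φ X = X)
    (hXN : ∀ n, e n ∈ X ↔ n ∈ pred N) {G : Type*} [Finite G] (ψ : L.Formula (N ⊕ G)) (w : G → N₁)
    (hw : ψ.Realize (Sum.elim e w)) :
    ∃ w' : G → N, ψ.Realize (Sum.elim id w') ∧ (∀ g, w g ∈ X → w' g ∈ pred N) ∧
      ∀ g, w g ∉ aclReduct φ (Set.range e ∪ X) → w' g ∉ pred N := by
  classical
  have := Fintype.ofFinite G
  have := nonempty_of_pairTheory φ T N
  have := model_of_pairTheory φ T N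
  have : N₁ ⊨ T := he.realize_theory
  have : Nonempty N₁ := ⟨e (Classical.arbitrary N)⟩
  have hcl := isFinitaryClosure_aclReduct φ N₁
  have hex := hT.exchange_aclReduct N₁
  have hmod := hT.modular_aclReduct N₁
  have hB : aclReduct φ (Set.range e) = Set.range e := he.aclReduct_range
  -- bases over `N`: `P` of the entries in `X`, and `Q` of all entries
  obtain ⟨P, -, hPF, hP, hPgen⟩ :=
    (indepSet_empty (cl := aclReduct φ) (Set.range e)).exists_extension hcl hex
      ((Finset.univ.image w).filter (· ∈ X))
  obtain ⟨Q, hPQ, hQF, hQ, hQgen⟩ := hP.exists_extension hcl hex (Finset.univ.image w)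
  rw [Set.empty_union] at hPF
  have hPfin : P.Finite := (Finset.finite_toSet _).subset hPF
  have hQfin : Q.Finite := (hPfin.union (Finset.finite_toSet _)).subset hQF
  have hPX : P ⊆ X := fun z hz => (Finset.mem_filter.1 (Finset.mem_coe.1 (hPF hz))).2
  have hQ' : ∀ g, w g ∈ aclReduct φ (e '' Set.univ ∪ Q) := fun g => by
    rw [Set.image_univ]
    exact hQgen (by simp)
  have hPmem : ∀ g : {g // w g ∈ X}, w g ∈ aclReduct φ (e '' pred N ∪ P) := fun g => by
    have hsub : e '' pred N ∪ P ⊆ X := by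
      rintro z (⟨n, hn, rfl⟩ | hz)
      · exact (hXN n).2 hn
      · exact hPX hz
    refine hmod.inter_cl_union_subset hcl hex hX hB (hcl.idem _) (hX ▸ hcl.mono hsub) ?_ ⟨g.2, ?_⟩
    · rintro _ ⟨hz, n, rfl⟩
      exact hcl.subset _ (Or.inl ⟨n, (hXN n).1 hz, rfl⟩)
    · refine hcl.mono (Set.union_subset_union_right _ ?_) (hPgen (by simp [g.2]))
      exact Set.subset_union_right.trans (hcl.subset _)
  have hstr : ∀ t ∈ aclReduct φ (e '' Set.univ ∪ Q), t ∉ aclReduct φ (Set.range e ∪ X) →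
      ∃ q : (Q \ P : Set N₁),
        (q : N₁) ∈ aclReduct φ (e '' Set.univ ∪ insert t (P ∪ ((Q \ P) \ {(q : N₁)}))) := by
    intro t ht htX
    have ht' : t ∉ aclReduct φ (Set.range e ∪ P) := fun h =>
      htX (hcl.mono (Set.union_subset_union_right _ hPX) h)
    obtain ⟨q, hq, hq'⟩ := hex.exists_mem_cl_insert hcl ht' (hQfin.sdiff (t := P)).toFinset (by
      rwa [Set.Finite.coe_toFinset, Set.union_assoc, Set.union_sdiff_cancel hPQ, ← Set.image_univ])
    rw [Set.Finite.mem_toFinset] at hq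
    refine ⟨⟨q, hq⟩, ?_⟩
    rwa [Set.Finite.coe_toFinset, Set.union_assoc, ← Set.union_insert, ← Set.image_univ] at hq'
  choose q hq using fun g : {g // w g ∉ aclReduct φ (Set.range e ∪ X)} => hstr _ (hQ' g) g.2
  -- finitely many parameters from `N` suffice
  choose F₁ _ hF₁ using fun g => hcl.exists_finset_image (hQ' g)
  choose F₂ hF₂S hF₂ using fun g => hcl.exists_finset_image (hPmem g)
  choose F₃ _ hF₃ using fun g => hcl.exists_finset_image (hq g)
  let β : Finset N := ((ψ.relabel Sum.swap).freeVarFinset.toRight ∪ Finset.univ.biUnion F₁) ∪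
    (Finset.univ.biUnion F₂ ∪ Finset.univ.biUnion F₃)
  have hβ : (ψ.relabel Sum.swap).freeVarFinset.toRight ⊆ β :=
    Finset.subset_union_left.trans Finset.subset_union_left
  have hβ₁ : ∀ g, F₁ g ⊆ β := fun g => (Finset.subset_biUnion_of_mem F₁ (Finset.mem_univ g)).trans
    (Finset.subset_union_right.trans Finset.subset_union_left)
  have hβ₂ : ∀ g, F₂ g ⊆ β := fun g => (Finset.subset_biUnion_of_mem F₂ (Finset.mem_univ g)).trans
    (Finset.subset_union_left.trans Finset.subset_union_right)
  have hβ₃ : ∀ g, F₃ g ⊆ β := fun g => (Finset.subset_biUnion_of_mem F₃ (Finset.mem_univ g)).trans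
    (Finset.subset_union_right.trans Finset.subset_union_right)
  have := hPfin.to_subtype
  have : Finite (Q \ P : Set N₁) := (hQfin.sdiff (t := P)).to_subtype
  let _ : L₀.Structure N := φ.reduct N
  let _ : L₀.Structure N₁ := φ.reduct N₁
  have h₂ : ∀ g : {g // w g ∈ X}, ∃ (χ : L₀.Formula (({b : β // (b : N) ∈ pred N} ⊕ P) ⊕ Unit))
      (k : ℕ), w g ∈ solutions (bounded χ k) (Sum.elim (fun b => e b.1) ((↑) : P → N₁)) := by
    intro g
    refine exists_bounded_of_mem_acl (hcl.mono ?_ (hF₂ g))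
    rw [Set.Sum.elim_range, Subtype.range_coe]
    refine Set.union_subset_union_left _ ?_
    rintro _ ⟨n, hn, rfl⟩
    exact ⟨⟨⟨n, hβ₂ g hn⟩, hF₂S g hn⟩, rfl⟩
  choose χ k hχ using h₂
  have hsub : ∀ F ⊆ β, e '' F ⊆ Set.range fun b : β => e b := by
    rintro F hF _ ⟨n, hn, rfl⟩
    exact ⟨⟨n, hF hn⟩, rfl⟩
  have h₃ := fun g : {g // w g ∉ aclReduct φ (Set.range e ∪ X)} =>
    exists_strict_formula.{u, v, max u v w, max u v w} (L₀ := L₀) (fun b : β => e b)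
      ((↑) : P → N₁) ((↑) : (Q \ P : Set N₁) → N₁) (w g) (q g) (hcl.mono (by
        rw [Subtype.range_coe, Subtype.range_coe, Set.union_assoc, Set.union_sdiff_cancel hPQ]
        exact Set.union_subset_union_left _ (hsub _ (hβ₁ g))) (hF₁ g)) (hcl.mono (by
        rw [Subtype.range_coe, Set.union_insert, Set.union_assoc]
        refine Set.insert_subset_insert (Set.union_subset_union (hsub _ (hβ₃ g))
          (Set.union_subset_union_right _ ?_))
        exact fun z hz => ⟨⟨z, hz.1⟩, fun h => hz.2 (congrArg Subtype.val h), rfl⟩) (hF₃ g))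
  choose τ hτ hτalg hτstrict using h₃
  let ψ₁ : L.Formula (((β ⊕ (P ⊕ (Q \ P : Set N₁)))) ⊕ G) :=
    (restrictRight (ψ.relabel Sum.swap) hβ).relabel
      (Sum.elim Sum.inr fun b => Sum.inl (Sum.inl b)) ⊓
    ((Formula.iInf fun g : {g // w g ∈ X} => (φ.onFormula (bounded (χ g) (k g))).relabel
      (Sum.map (Sum.map (fun b => b.1) Sum.inl) fun _ => (g : G))) ⊓
    (Formula.iInf fun g : {g // w g ∉ aclReduct φ (Set.range e ∪ X)} =>
      (φ.onFormula (τ g)).relabel (Sum.map id fun _ => (g : G))))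
  have hψ₁ : ∀ {M : Type (max u v w)} [L₀.Structure M] [L.Structure M] [φ.IsExpansionOn M]
    (b : N → M) (x : P ⊕ (Q \ P : Set N₁) → M) (z : G → M),
    ψ₁.Realize (Sum.elim (Sum.elim (fun n : β => b n) x) z) ↔
      ψ.Realize (Sum.elim b z) ∧
      (∀ g : {g // w g ∈ X}, z g ∈ solutions (bounded (χ g) (k g))
        (Sum.elim (fun n => b n.1) (x ∘ Sum.inl))) ∧
      ∀ g : {g // w g ∉ aclReduct φ (Set.range e ∪ X)}, z g ∈ solutions (τ g)
        (Sum.elim (fun n : β => b n) x) := by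
    intro M _ _ _ b x z
    simp only [ψ₁, Formula.realize_inf, Formula.realize_iInf, Formula.realize_relabel,
      LHom.realize_onFormula]
    refine and_congr ?_ (and_congr (forall_congr' fun g => ?_) (forall_congr' fun g => ?_))
    · have := realize_restrictRight (ψ.relabel Sum.swap) hβ z b
      rw [Formula.realize_relabel] at this
      refine Iff.trans (iff_of_eq (congrArg _ ?_)) (this.trans (iff_of_eq (congrArg _ ?_)))
      · ext (c | c) <;> rfl
      · ext (c | c) <;> rfl
    · refine iff_of_eq (congrArg (bounded (χ g) (k g)).Realize ?_)
      ext ((c | c) | c) <;> rfl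
    · refine iff_of_eq (congrArg (τ g).Realize ?_)
      ext (c | c) <;> rfl
  obtain ⟨x, hx, hxP, hxQ⟩ := hT.exists_generic_solution_of_finite he (Formula.iExs G ψ₁) τ hτalg
    (fun g M _ _ _ => hτstrict g M) ((↑) : β → N)
    (Sum.elim ((↑) : P → N₁) ((↑) : (Q \ P : Set N₁) → N₁))
    (Formula.realize_iExs.2 ⟨w, (hψ₁ e _ w).2 ⟨hw, hχ, hτ⟩⟩)
    (hQ.indepTuple (Function.Injective.sumElim Subtype.coe_injective Subtype.coe_injective
      fun a b hab => b.2.2 (hab ▸ a.2)) (by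
      rintro _ ⟨a | a, rfl⟩
      · exact hPQ a.2
      · exact a.2.1) hcl)
  obtain ⟨z, hz⟩ := Formula.realize_iExs.1 hx
  obtain ⟨hz₁, hz₂, hz₃⟩ := (hψ₁ id x z).1 hz
  refine ⟨z, hz₁, fun g hg => ?_, fun g hg => hxQ ⟨g, hg⟩ _ (hz₃ ⟨g, hg⟩)⟩
  have h₄ : aclReduct φ (pred N) = pred N := hT.aclReduct_pred N
  rw [← h₄]
  refine acl_mono (L := L₀) ?_ (solutions_bounded_subset_acl _ _ _ (hz₂ ⟨g, hg⟩))
  rintro _ ⟨b | b, rfl⟩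
  · exact b.2
  · exact hxP b

end Core

/-! ### Extending partial isomorphisms -/

section Extension

variable {L₀ L : FirstOrder.Language.{u, v}} {φ : L₀ →ᴸ L} {T : L.Theory}

theorem EquivOver.mem_pred_iff {M N : Type*} [L.Structure M] [predLang.Structure M] [L.Structure N]
    [predLang.Structure N] {α : Type*} {i : α → M} {j : α → N} (h : EquivOver (LS L) i j) (a : α) :
    i a ∈ pred M ↔ j a ∈ pred N := by
  have := h ((symS L).formula₁ (Term.var a))
  rwa [Formula.realize_rel₁, Formula.realize_rel₁] at this

theorem sumStructure_reduct {N : Type*} (S : (LS L).Structure N) :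
    @sumStructure L predLang N ((LHom.sumInl : L →ᴸ LS L).reduct N)
      ((LHom.sumInr : predLang →ᴸ LS L).reduct N) = S := by
  ext n f x <;> rcases f with f | f <;> rfl

/-- Compactness for `L_S`, where the extension is presented by its two reducts. -/
theorem exists_LS_extension_realizing {N V : Type (max u v w)} [L.Structure N]
    [predLang.Structure N] [Nonempty N] {I : Type*} (Γ : I → (LS L).Formula (N ⊕ V))
    (hfin : ∀ s : Finset I, ∃ b : V → N, ∀ k ∈ s, (Γ k).Realize (Sum.elim id b)) :
    ∃ (N' : Type (max u v w)) (_ : L.Structure N') (_ : predLang.Structure N')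
      (e : N → N') (b : V → N'), EquivOver (LS L) id e ∧ ∀ k, (Γ k).Realize (Sum.elim e b) := by
  obtain ⟨N', S, -, e, b, he, hb⟩ := exists_extension_realizing.{u, v, w} Γ hfin
  refine ⟨N', (LHom.sumInl : L →ᴸ LS L).reduct N', (LHom.sumInr : predLang →ᴸ LS L).reduct N',
    e, b, ?_, ?_⟩
  · rw [sumStructure_reduct S]
    exact he
  · rw [sumStructure_reduct S]
    exact hb

/-- Let `N` be a model of `TS`. An `L`-elementary extension `N₁` of `N`, with an `acl₀`-closed set
`X` such that `X ∩ N = S(N)`, embeds over `N` into an `L_S`-elementary extension of `N`. It suffices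
to realize that entries in `X` lie in `S` and that entries outside `acl₀(N ∪ X)` do not: by
modularity the remaining elements do not lie in `S` either. -/
theorem Suitable.exists_extension_of_closed (hT : Suitable.{u, v, w} φ T) {N N₁ : Type (max u v w)}
    [L.Structure N] [predLang.Structure N] [L.Structure N₁] [N ⊨ genericTheory.{u, v, w} φ T]
    {e : N → N₁} (he : EquivOver L id e) {X : Set N₁} (hX : aclReduct φ X = X)
    (hXN : ∀ n, e n ∈ X ↔ n ∈ pred N) :
    ∃ (N' : Type (max u v w)) (_ : L.Structure N') (_ : predLang.Structure N')
      (e' : N → N') (h : N₁ → N'), EquivOver (LS L) id e' ∧ EquivOver L id h ∧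
        (∀ n, h (e n) = e' n) ∧ ∀ t, h t ∈ pred N' ↔ t ∈ X := by
  classical
  have := nonempty_of_pairTheory φ T N
  let Γ : {ψ : L.Formula (N ⊕ N₁) // ψ.Realize (Sum.elim e id)} ⊕
      (X ⊕ {t // t ∉ aclReduct φ (Set.range e ∪ X)}) → (LS L).Formula (N ⊕ N₁) :=
    Sum.elim (fun ψ => (LHom.sumInl : L →ᴸ LS L).onFormula ψ.1) (Sum.elim
      (fun t => (symS L).formula₁ (Term.var (Sum.inr (t : N₁))))
      fun t => ((symS L).formula₁ (Term.var (Sum.inr (t : N₁)))).not)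
  obtain ⟨N', _, _, e', h, he', hΓ⟩ := exists_LS_extension_realizing.{u, v, w} Γ fun s => by
    let ψ : L.Formula (N ⊕ N₁) := Formula.iInf fun k : s.toLeft => k.1.1
    let G : Finset N₁ := ψ.freeVarFinset.toRight ∪
      (s.toRight.toLeft.image Subtype.val ∪ s.toRight.toRight.image Subtype.val)
    have hG : ψ.freeVarFinset.toRight ⊆ G := Finset.subset_union_left
    obtain ⟨w', hw', hin, hout⟩ := hT.exists_solution he hX hXN (restrictRight ψ hG)
      (fun t : G => t)
      ((realize_restrictRight ψ hG e id).2 (Formula.realize_iInf.2 fun k => k.1.2))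
    obtain ⟨b, rfl⟩ := exists_extend_finset w'
    rw [realize_restrictRight] at hw'
    refine ⟨b, ?_⟩
    rintro (k | t | t) hk
    · exact (LHom.realize_onFormula _ _).2
        (Formula.realize_iInf.1 hw' ⟨k, Finset.mem_toLeft.2 hk⟩)
    · have ht : (t : N₁) ∈ G := Finset.mem_union_right _ (Finset.mem_union_left _
        (Finset.mem_image_of_mem _ (Finset.mem_toLeft.2 (Finset.mem_toRight.2 hk))))
      exact Formula.realize_rel₁.2 (hin ⟨t, ht⟩ t.2)
    · have ht : (t : N₁) ∈ G := Finset.mem_union_right _ (Finset.mem_union_right _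
        (Finset.mem_image_of_mem _ (Finset.mem_toRight.2 (Finset.mem_toRight.2 hk))))
      exact Formula.realize_not.2 fun h => hout ⟨t, ht⟩ t.2 (Formula.realize_rel₁.1 h)
  have hψ : ∀ ψ : L.Formula (N ⊕ N₁), ψ.Realize (Sum.elim e id) → ψ.Realize (Sum.elim e' h) :=
    fun ψ hψ => (LHom.realize_onFormula (LHom.sumInl : L →ᴸ LS L) ψ).1 (hΓ (Sum.inl ⟨ψ, hψ⟩))
  have hh : EquivOver L id h := by
    have h1 : ∀ ψ : L.Formula N₁, ψ.Realize id → ψ.Realize h := fun ψ hψ' => by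
      have := Formula.realize_relabel.1 (hψ (ψ.relabel Sum.inr) (Formula.realize_relabel.2 hψ'))
      exact this
    refine fun ψ => ⟨h1 ψ, fun hψ' => ?_⟩
    by_contra hne
    exact Formula.realize_not.1 (h1 ψ.not (Formula.realize_not.2 hne)) hψ'
  have hhe : ∀ n, h (e n) = e' n := fun n => by
    simpa [Formula.realize_equal] using
      hψ (Term.equal (Term.var (Sum.inr (e n))) (Term.var (Sum.inl n))) (by
        simp [Formula.realize_equal])
  have hin : ∀ t ∈ X, h t ∈ pred N' := fun t ht =>
    Formula.realize_rel₁.1 (hΓ (Sum.inr (Sum.inl ⟨t, ht⟩)))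
  have hout : ∀ t, t ∉ aclReduct φ (Set.range e ∪ X) → h t ∉ pred N' := fun t ht hmem =>
    Formula.realize_not.1 (hΓ (Sum.inr (Sum.inr ⟨t, ht⟩))) (Formula.realize_rel₁.2 hmem)
  refine ⟨N', inferInstance, inferInstance, e', h, he', hh, hhe, fun t => ⟨fun ht => ?_, hin t⟩⟩
  have : N' ⊨ genericTheory.{u, v, w} φ T := he'.realize_theory
  have := nonempty_of_pairTheory φ T N'
  have := model_of_pairTheory φ T N'
  have hmem : t ∈ aclReduct φ (Set.range e ∪ X) := by
    by_contra hne
    exact hout t hne ht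
  have he'' : EquivOver L id e' := he'.of_expansion (LHom.sumInl : L →ᴸ LS L)
  have h2 := (hT.modular_aclReduct N').inter_cl_union_subset (isFinitaryClosure_aclReduct φ N')
    (hT.exchange_aclReduct N') (P := pred N') (B := Set.range e') (C := h '' X)
    (hT.aclReduct_pred N') he''.aclReduct_range (by rw [hh.aclReduct_image, hX]) (by
      rintro _ ⟨t, ht, rfl⟩
      exact hin t ht) (by
      rintro _ ⟨hz, n, rfl⟩
      exact ⟨e n, (hXN n).2 ((he'.mem_pred_iff n).2 hz), hhe n⟩)
  have h3 : h t ∈ aclReduct φ (Set.range e' ∪ h '' X) := by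
    have : Set.range e' ∪ h '' X = h '' (Set.range e ∪ X) := by
      rw [Set.image_union, ← Set.range_comp]
      congr 2
      exact funext fun n => (hhe n).symm
    rw [this, hh.aclReduct_image]
    exact ⟨t, hmem, rfl⟩
  obtain ⟨s, hs, hst⟩ := h2 ⟨ht, h3⟩
  exact hh.injective hst ▸ hs

/-- Let `i a ↦ j a` be a partial `L`-elementary `L_S`-isomorphism between models `M` and `N` of `TS`
whose domain is `acl_T`-closed. It extends to an `L`-elementary `L_S`-embedding of `M` into an
`L_S`-elementary extension of `N`, and the image of `M` can be made to meet `N` only in the image of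
the given map. -/
theorem Suitable.exists_extension (hT : Suitable.{u, v, w} φ T) {M N : Type (max u v w)}
    [L.Structure M] [predLang.Structure M] [L.Structure N] [predLang.Structure N]
    [M ⊨ genericTheory.{u, v, w} φ T] [N ⊨ genericTheory.{u, v, w} φ T] {α : Type*} {i : α → M}
    {j : α → N} (h : EquivOver L i j) (hi : acl L (Set.range i) = Set.range i)
    (hS : ∀ a, i a ∈ pred M ↔ j a ∈ pred N) :
    ∃ (N' : Type (max u v w)) (_ : L.Structure N') (_ : predLang.Structure N')
      (e : N → N') (g : M → N'), EquivOver (LS L) id e ∧ EquivOver L id g ∧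
        (∀ a, g (i a) = e (j a)) ∧ (∀ m, m ∈ pred M ↔ g m ∈ pred N') ∧
          ∀ m n, g m = e n → m ∈ Set.range i := by
  have := nonempty_of_pairTheory φ T N
  have := model_of_pairTheory φ T N
  obtain ⟨K, _, _, e, g, he, hg, hge, hmeet⟩ := h.exists_amalgam hi
  have : K ⊨ T := he.realize_theory
  have hcl := isFinitaryClosure_aclReduct φ K
  have hex := hT.exchange_aclReduct K
  have hmod := hT.modular_aclReduct K
  have hN : aclReduct φ (e '' pred N) = e '' pred N := by
    rw [he.aclReduct_image, hT.aclReduct_pred]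
  have hM : aclReduct φ (g '' pred M) = g '' pred M := by
    rw [hg.aclReduct_image, hT.aclReduct_pred]
  have hinter : ∀ m n, g m = e n → (m ∈ pred M ↔ n ∈ pred N) := fun m n hmn => by
    obtain ⟨a, rfl⟩ := hmeet m n hmn
    rw [← he.injective ((hge a).symm.trans hmn)]
    exact hS a
  have h1 := hmod.inter_cl_union_subset hcl hex (P := Set.range g) (B := e '' pred N)
    (C := g '' pred M) hg.aclReduct_range hN hM (Set.image_subset_range _ _) (by
      rintro _ ⟨⟨m, rfl⟩, n, hn, hmn⟩
      exact ⟨m, (hinter m n hmn.symm).2 hn, rfl⟩)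
  have h2 := hmod.inter_cl_union_subset hcl hex (P := Set.range e) (B := g '' pred M)
    (C := e '' pred N) he.aclReduct_range hM hN (Set.image_subset_range _ _) (by
      rintro _ ⟨⟨n, rfl⟩, m, hm, hmn⟩
      exact ⟨n, (hinter m n hmn).1 hm, rfl⟩)
  have hX1 : ∀ m, g m ∈ aclReduct φ (e '' pred N ∪ g '' pred M) ↔ m ∈ pred M := fun m => by
    refine ⟨fun hm => ?_, fun hm => hcl.subset _ (Or.inr ⟨m, hm, rfl⟩)⟩
    obtain ⟨m', hm', h'⟩ := h1 ⟨⟨m, rfl⟩, hm⟩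
    exact hg.injective h' ▸ hm'
  have hX2 : ∀ n, e n ∈ aclReduct φ (e '' pred N ∪ g '' pred M) ↔ n ∈ pred N := fun n => by
    refine ⟨fun hn => ?_, fun hn => hcl.subset _ (Or.inl ⟨n, hn, rfl⟩)⟩
    rw [Set.union_comm] at hn
    obtain ⟨n', hn', h'⟩ := h2 ⟨⟨n, rfl⟩, hn⟩
    exact he.injective h' ▸ hn'
  obtain ⟨N', _, _, e', k, he', hk, hke, hkX⟩ := hT.exists_extension_of_closed he (hcl.idem _) hX2
  refine ⟨N', inferInstance, inferInstance, e', k ∘ g, he', fun ψ => (hg ψ).trans (hk.comp g ψ),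
    fun a => ?_, fun m => ?_, fun m n hmn => hmeet m n (hk.injective ?_)⟩
  · rw [Function.comp_apply, hge, hke]
  · rw [Function.comp_apply, hkX, hX1]
  · rw [hke]
    exact hmn

end Extension

/-! ### Elementarity of partial isomorphisms -/

section Elementarity

variable {L₀ L : FirstOrder.Language.{u, v}} {φ : L₀ →ᴸ L} {T : L.Theory}

theorem exists_onTerm_eq {γ : Type*} (t : (LS L).Term γ) :
    ∃ t' : L.Term γ, (LHom.sumInl : L →ᴸ LS L).onTerm t' = t := by
  induction t with
  | var a => exact ⟨Term.var a, rfl⟩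
  | func f ts ih =>
    choose ts' hts using ih
    rcases f with f | f
    · exact ⟨Term.func f ts', congrArg (Term.func (L := LS L) (Sum.inl f)) (funext hts)⟩
    · exact f.elim

/-- A partial `L`-elementary `L_S`-isomorphism between models of `TS` with `acl_T`-closed domain
preserves all `L_S`-formulas. In the induction on formulas, a witness of a quantifier is dealt with
by extending the map to all of one model, at the cost of an elementary extension of the other. -/
theorem Suitable.realize_iff (hT : Suitable.{u, v, w} φ T) {γ : Type*} {n : ℕ}
    (ψ : (LS L).BoundedFormula γ n) {M N α : Type (max u v w)}
    [L.Structure M] [predLang.Structure M] [L.Structure N] [predLang.Structure N]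
    [M ⊨ genericTheory.{u, v, w} φ T] [N ⊨ genericTheory.{u, v, w} φ T] {i : α → M}
    {j : α → N} (h : EquivOver L i j) (hi : acl L (Set.range i) = Set.range i)
    (hS : ∀ a, i a ∈ pred M ↔ j a ∈ pred N) (v : γ → α) (xs : Fin n → α) :
    ψ.Realize (i ∘ v) (i ∘ xs) ↔ ψ.Realize (j ∘ v) (j ∘ xs) := by
  induction ψ generalizing M N α with
  | falsum => exact Iff.rfl
  | equal t₁ t₂ =>
    obtain ⟨s₁, rfl⟩ := exists_onTerm_eq t₁
    obtain ⟨s₂, rfl⟩ := exists_onTerm_eq t₂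
    have := h.comp (Sum.elim v xs) (Term.equal s₁ s₂)
    rw [Formula.realize_equal, Formula.realize_equal, Sum.comp_elim, Sum.comp_elim] at this
    change Term.realize _ _ = Term.realize _ _ ↔ Term.realize _ _ = Term.realize _ _
    simpa only [LHom.realize_onTerm] using this
  | @rel n l R ts =>
    choose ss hss using fun k => exists_onTerm_eq (ts k)
    obtain rfl : (fun k => (LHom.sumInl : L →ᴸ LS L).onTerm (ss k)) = ts := funext hss
    change Structure.RelMap _ _ ↔ Structure.RelMap _ _
    simp only [LHom.realize_onTerm, ← Sum.comp_elim]
    rcases R with R | R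
    · have := h.comp (Sum.elim v xs) (Relations.formula R ss)
      rw [Formula.realize_rel, Formula.realize_rel] at this
      exact this
    · cases R with
      | S =>
        have key : ∀ {K : Type (max u v w)} [L.Structure K] [predLang.Structure K] (x : Fin 1 → K),
            Structure.RelMap (symS L) x ↔ x 0 ∈ pred K := fun x => by
          rw [← relMap_symS (L := L)]
          refine iff_of_eq (congrArg _ ?_)
          ext k
          fin_cases k
          rfl
        refine (key _).trans (Iff.trans ?_ (key _).symm)
        -- the value of the term is algebraic, hence in the domain of the map
        obtain ⟨a, ha⟩ : (ss 0).realize (i ∘ Sum.elim v xs) ∈ Set.range i := by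
          rw [← hi]
          have h1 : (ss 0).realize (i ∘ Sum.elim v xs) ∈ solutions (Term.equal
              ((ss 0).relabel Sum.inl) (Term.var (Sum.inr ())) : L.Formula (_ ⊕ Unit))
              (i ∘ Sum.elim v xs) := by
            simp [solutions, Formula.realize_equal, Term.realize_relabel]
          refine acl_mono ?_ (mem_acl_range_iff.2 ⟨_, ?_, h1⟩)
          · exact Set.range_comp_subset_range _ _
          · refine (Set.finite_singleton ((ss 0).realize (i ∘ Sum.elim v xs))).subset fun t ht => ?_
            simpa [solutions, Formula.realize_equal, Term.realize_relabel, eq_comm] using ht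
        have h2 := h (Term.equal ((ss 0).relabel (Sum.elim v xs)) (Term.var a))
        simp only [Formula.realize_equal, Term.realize_relabel, Term.realize_var] at h2
        rw [h2.1 ha.symm, ← ha]
        exact hS a
  | imp ψ₁ ψ₂ ih₁ ih₂ => exact imp_congr (ih₁ h hi hS v xs) (ih₂ h hi hS v xs)
  | all ψ ih =>
    -- it suffices to transfer counterexamples, by the symmetry of the situation
    have key : ∀ {M N α : Type (max u v w)} [L.Structure M] [predLang.Structure M] [L.Structure N]
        [predLang.Structure N] [M ⊨ genericTheory.{u, v, w} φ T]
        [N ⊨ genericTheory.{u, v, w} φ T] {i : α → M} {j : α → N}, EquivOver L i j →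
        acl L (Set.range i) = Set.range i → (∀ a, i a ∈ pred M ↔ j a ∈ pred N) →
        ∀ (v : γ → α) (xs : Fin _ → α), ψ.all.Realize (j ∘ v) (j ∘ xs) →
          ψ.all.Realize (i ∘ v) (i ∘ xs) := by
      intro M N α _ _ _ _ _ _ i j h hi hS v xs hall t
      obtain ⟨N', _, _, e, g, he, hg, hge, hgS, -⟩ := hT.exists_extension h hi hS
      have : N' ⊨ genericTheory.{u, v, w} φ T := he.realize_theory
      have hsnoc : ∀ (g : M → N'), g ∘ (Fin.snoc (i ∘ xs) t : Fin _ → M) =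
          Fin.snoc (g ∘ i ∘ xs) (g t) := fun g => Fin.comp_snoc _ _ _
      have h1 := ih (i := id) (j := g) hg (by
        rw [Set.range_id]
        exact Set.univ_subset_iff.1 (subset_acl L _)) hgS (i ∘ v) (Fin.snoc (i ∘ xs) t)
      rw [Function.id_comp, Function.id_comp, hsnoc] at h1
      refine h1.2 ?_
      have h2 : ψ.all.Realize ((e ∘ j) ∘ v) ((e ∘ j) ∘ xs) :=
        (he.toElementaryEmbedding.map_boundedFormula ψ.all (j ∘ v) (j ∘ xs)).2 hall
      rw [show e ∘ j = g ∘ i from funext fun a => (hge a).symm] at h2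
      exact BoundedFormula.realize_all.1 h2 (g t)
    exact ⟨key h.symm (h.acl_range_eq hi) (fun a => (hS a).symm) v xs, key h hi hS v xs⟩

theorem Suitable.equivOver_LS (hT : Suitable.{u, v, w} φ T) {M N α : Type (max u v w)}
    [L.Structure M] [predLang.Structure M] [L.Structure N] [predLang.Structure N]
    [M ⊨ genericTheory.{u, v, w} φ T] [N ⊨ genericTheory.{u, v, w} φ T] {i : α → M}
    {j : α → N} (h : EquivOver L i j) (hi : acl L (Set.range i) = Set.range i)
    (hS : ∀ a, i a ∈ pred M ↔ j a ∈ pred N) : EquivOver (LS L) i j := fun ψ => by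
  have := hT.realize_iff ψ h hi hS id Fin.elim0
  simp only [Function.comp_id] at this
  rw [Formula.Realize, Formula.Realize]
  convert this

end Elementarity

/-! ### Types and algebraic closure in models of `TS` -/

section Types

variable {L₀ L : FirstOrder.Language.{u, v}} {φ : L₀ →ᴸ L} {T : L.Theory}

theorem equivOver_of_forall_fin {M N : Type*} [L.Structure M] [L.Structure N] {α : Type*}
    {i : α → M} {j : α → N}
    (h : ∀ (n : ℕ) (ψ : L.Formula (Fin n)) (c : Fin n → α),
      ψ.Realize (fun k => i (c k)) ↔ ψ.Realize fun k => j (c k)) : EquivOver L i j := fun ψ => by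
  classical
  let s := ψ.freeVarFinset
  have h1 := h s.card (BoundedFormula.restrictFreeVar ψ s.equivFin) fun k => s.equivFin.symm k
  rw [Formula.Realize, Formula.Realize, BoundedFormula.realize_restrictFreeVar i (by simp [s]),
    BoundedFormula.realize_restrictFreeVar j (by simp [s])] at h1
  exact h1

theorem IsElementaryLSIso.mem_pred_iff {M N : Type*} [L.Structure M] [L.Structure N]
    [predLang.Structure M] [predLang.Structure N] {A : Set M} {B : Set N} {f : acl L A ≃ acl L B}
    (hf : IsElementaryLSIso L f) (x : acl L A) : (x : M) ∈ pred M ↔ (f x : N) ∈ pred N := by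
  constructor
  · intro hx
    have : (f x : N) ∈ pred N ∩ acl L B := hf.map_pred ▸ ⟨x, hx, rfl⟩
    exact this.1
  · intro hx
    have : (f x : N) ∈ (fun x => (f x : N)) '' {x | (x : M) ∈ pred M} := by
      rw [hf.map_pred]
      exact ⟨hx, (f x).2⟩
    obtain ⟨y, hy, hyx⟩ := this
    exact f.injective (Subtype.ext hyx) ▸ hy

/-- If two tuples have the same `L_S`-type, then the structures embed into a common elementary
extension where the tuples agree, and there their algebraic closures coincide. -/
theorem exists_elementaryLSIso {M N α : Type (max u v w)} [L.Structure M]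
    [predLang.Structure M] [L.Structure N] [predLang.Structure N] [Nonempty N] {i : α → M}
    {j : α → N} (h : EquivOver (LS L) i j) :
    ∃ f : acl L (Set.range i) ≃ acl L (Set.range j), IsElementaryLSIso L f ∧
      ∀ (a : α) (x : acl L (Set.range i)), (x : M) = i a → (f x : N) = j a := by
  obtain ⟨K, _, e, g, he, hg, hge⟩ := EquivOver.exists_joint_extension.{u, v, w} h
  let _ : L.Structure K := (LHom.sumInl : L →ᴸ LS L).reduct K
  have heL : EquivOver L id e := he.of_expansion (LHom.sumInl : L →ᴸ LS L)
  have hgL : EquivOver L id g := hg.of_expansion (LHom.sumInl : L →ᴸ LS L)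
  have himage : g '' acl L (Set.range i) = e '' acl L (Set.range j) := by
    rw [← heL.acl_image, ← hgL.acl_image, ← Set.range_comp, ← Set.range_comp]
    exact congrArg (fun l => acl L (Set.range l)) (funext hge)
  let f : acl L (Set.range i) ≃ acl L (Set.range j) :=
    (Equiv.Set.image g _ hgL.injective).trans ((Equiv.setCongr himage).trans
      (Equiv.Set.image e _ heL.injective).symm)
  have hf : ∀ x, e (f x) = g x := fun x =>
    congrArg Subtype.val ((Equiv.Set.image e _ heL.injective).apply_symm_apply _)
  have hpred : ∀ x : acl L (Set.range i), (x : M) ∈ pred M ↔ (f x : N) ∈ pred N := fun x => by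
    have h1 := hg.comp (fun _ : Unit => (x : M)) ((symS L).formula₁ (Term.var ()))
    have h2 := he.comp (fun _ : Unit => (f x : N)) ((symS L).formula₁ (Term.var ()))
    have h3 : (g ∘ fun _ : Unit => (x : M)) = e ∘ fun _ : Unit => (f x : N) :=
      funext fun _ => (hf x).symm
    rw [h3, ← h2] at h1
    rwa [Formula.realize_rel₁, Formula.realize_rel₁] at h1
  refine ⟨f, ⟨fun n ψ c => ?_, ?_⟩, fun a x hx => heL.injective ?_⟩
  · have h1 := hgL.comp (fun k => (c k : M)) ψ
    have h2 := heL.comp (fun k => (f (c k) : N)) ψ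
    have h3 : (g ∘ fun k => (c k : M)) = e ∘ fun k => (f (c k) : N) :=
      funext fun k => (hf (c k)).symm
    rw [h3, ← h2] at h1
    exact h1
  · ext y
    constructor
    · rintro ⟨x, hx, rfl⟩
      exact ⟨(hpred x).1 hx, (f x).2⟩
    · rintro ⟨hy, hyB⟩
      refine ⟨f.symm ⟨y, hyB⟩, (hpred _).2 ?_, ?_⟩ <;> simp [hy]
  · rw [hf, hx, hge]

/-- Two tuples in models of `TS` have the same `L_S`-type if and only if the map between them
extends to a `T`-elementary `L_S`-isomorphism of their `acl_T`-closures. -/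
theorem Suitable.equivOver_iff (hT : Suitable.{u, v, w} φ T) {M N α : Type (max u v w)}
    [L.Structure M] [predLang.Structure M] [L.Structure N] [predLang.Structure N]
    [M ⊨ genericTheory.{u, v, w} φ T] [N ⊨ genericTheory.{u, v, w} φ T] {i : α → M}
    {j : α → N} {A : Set M} {B : Set N} (hA : Set.range i = A) (hB : Set.range j = B) :
    EquivOver (LS L) i j ↔ ∃ f : acl L A ≃ acl L B, IsElementaryLSIso L f ∧
      ∀ (a : α) (x : acl L A), (x : M) = i a → (f x : N) = j a := by
  subst hA hB
  have := nonempty_of_pairTheory φ T N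
  refine ⟨exists_elementaryLSIso.{u, v, w}, fun ⟨f, hf, hij⟩ => ?_⟩
  have h1 : EquivOver L ((↑) : acl L (Set.range i) → M) fun x => (f x : N) :=
    equivOver_of_forall_fin hf.elementary
  have h2 := hT.equivOver_LS h1 (by rw [Subtype.range_coe, acl_acl]) hf.mem_pred_iff
  have h3 := h2.comp fun a => (⟨i a, subset_acl L _ ⟨a, rfl⟩⟩ : acl L (Set.range i))
  have h4 : (fun x => (f x : N)) ∘ (fun a => (⟨i a, subset_acl L _ ⟨a, rfl⟩⟩ :
      acl L (Set.range i))) = j := funext fun a => hij a _ rfl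
  rw [h4] at h3
  exact h3

theorem completeTheory_eq_iff_equivOver {L : FirstOrder.Language.{u, v}} {M N : Type*}
    [L.Structure M] [L.Structure N] {α : Type*} [IsEmpty α] (i : α → M) (j : α → N) :
    L.completeTheory M = L.completeTheory N ↔ EquivOver L i j := by
  rw [Set.ext_iff]
  constructor
  · intro h ψ
    have h1 := h (Formula.relabel isEmptyElim ψ)
    rw [mem_completeTheory, mem_completeTheory, Sentence.Realize, Sentence.Realize,
      Formula.realize_relabel, Formula.realize_relabel] at h1
    convert h1
  · intro h σ
    have h1 := h (Formula.relabel Empty.elim σ)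
    rw [Formula.realize_relabel, Formula.realize_relabel] at h1
    rw [mem_completeTheory, mem_completeTheory, Sentence.Realize, Sentence.Realize]
    convert h1

theorem exists_model_completeTheory_eq {T' : (LS L).Theory} (hT' : T'.IsMaximal) :
    ∃ (M : Type (max u v w)) (_ : L.Structure M) (_ : predLang.Structure M),
      M ⊨ T' ∧ (LS L).completeTheory M = T' := by
  obtain ⟨⟨M₀⟩, hmax⟩ := hT'
  let M : T'.ModelType := Theory.ModelType.ulift.{u, v, max u v, w} M₀
  have h1 : (LS L).completeTheory M = T' := by
    refine Set.Subset.antisymm (fun σ hσ => ?_) (Theory.completeTheory.subset (M := M))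
    refine (hmax σ).resolve_right fun h => ?_
    exact (Sentence.realize_not M).1 (Theory.realize_sentence_of_mem T' h) hσ
  refine ⟨M, (LHom.sumInl : L →ᴸ LS L).reduct M, (LHom.sumInr : predLang →ᴸ LS L).reduct M, ?_⟩
  rw [sumStructure_reduct M.struc]
  exact ⟨M.is_model, h1⟩

/-- Algebraic closure in `TS` is algebraic closure in `T`: for an `acl_T`-closed set `A` of the
model `M` there is an elementary extension of `M` containing a second elementary copy of `M` that
meets `M` only in `A`. -/
theorem Suitable.acl_LS_eq (hT : Suitable.{u, v, w} φ T) (M : Type (max u v w)) [L.Structure M]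
    [predLang.Structure M] [M ⊨ genericTheory.{u, v, w} φ T] (A : Set M) :
    acl (LS L) A = acl L A := by
  refine Set.Subset.antisymm (fun x hx => ?_) ?_
  · have hr : Set.range ((↑) : acl L A → M) = acl L A := Subtype.range_coe
    obtain ⟨N, _, _, e, g, he, hg, hge, hS, hmeet⟩ := hT.exists_extension
      (i := ((↑) : acl L A → M)) (j := ((↑) : acl L A → M)) (fun _ => Iff.rfl)
      (by rw [hr, acl_acl]) fun _ => Iff.rfl
    have : N ⊨ genericTheory.{u, v, w} φ T := he.realize_theory
    have hgS : EquivOver (LS L) id g := hT.equivOver_LS hg (by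
      rw [Set.range_id]
      exact Set.univ_subset_iff.1 (subset_acl L _)) hS
    have hA : g '' A = e '' A := Set.image_congr fun a ha => hge ⟨a, subset_acl L A ha⟩
    have h1 : g x ∈ e '' acl (LS L) A := by
      rw [← he.acl_image, ← hA, hgS.acl_image]
      exact ⟨x, hx, rfl⟩
    obtain ⟨y, -, hy⟩ := h1
    have := hmeet x y hy.symm
    rwa [hr] at this
  · rintro x ⟨D, hD, hfin, hx⟩
    exact ⟨D, hD.map_expansion (LHom.sumInl : L →ᴸ LS L), hfin, hx⟩

end Types

end GenericExpansion

theorem proposition1p10 {L₀ L : FirstOrder.Language.{u, v}} (φ : L₀ →ᴸ L) (T : L.Theory)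
    (hT : Suitable.{u, v, w} φ T) :
    -- (1) elementary equivalence of models over a common subset `A`
    (∀ (M N : Type (max u v w)) [L.Structure M] [L.Structure N]
        [predLang.Structure M] [predLang.Structure N]
        [M ⊨ genericTheory.{u, v, w} φ T] [N ⊨ genericTheory.{u, v, w} φ T]
        (A : Type (max u v w)) (i : A ↪ M) (j : A ↪ N),
      EquivOver (LS L) i j ↔
        ∃ f : acl L (Set.range i) ≃ acl L (Set.range j), IsElementaryLSIso L f ∧
          ∀ a : A, (f ⟨i a, subset_acl L _ ⟨a, rfl⟩⟩ : N) = j a) ∧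
    -- (2) equality of the types of two tuples over `A`
    (∀ (M : Type (max u v w)) [L.Structure M] [predLang.Structure M]
        [M ⊨ genericTheory.{u, v, w} φ T]
        (A : Set M) (ι : Type (max u v w)) (a b : ι → M),
      EquivOver (LS L) (Sum.elim (fun x : A => (x : M)) a) (Sum.elim (fun x : A => (x : M)) b) ↔
        ∃ f : acl L (A ∪ Set.range a) ≃ acl L (A ∪ Set.range b), IsElementaryLSIso L f ∧
          (∀ (x : M) (hx : x ∈ A), (f ⟨x, subset_acl L _ (Or.inl hx)⟩ : M) = x) ∧
          ∀ k : ι, (f ⟨a k, subset_acl L _ (Or.inr ⟨k, rfl⟩)⟩ : M) = b k) ∧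
    -- (3) `M ↦ Th(M)` maps the models of `TS` onto the completions of `TS`, and its fibres are
    -- the isomorphism types of `(acl_T(∅), S(acl_T(∅)))`
    ((∀ (M : Type (max u v w)) [L.Structure M] [predLang.Structure M]
        [M ⊨ genericTheory.{u, v, w} φ T],
        ((LS L).completeTheory M).IsMaximal ∧
          genericTheory.{u, v, w} φ T ⊆ (LS L).completeTheory M) ∧
      (∀ T' : (LS L).Theory, T'.IsMaximal → genericTheory.{u, v, w} φ T ⊆ T' →
        ∃ (M : Type (max u v w)) (_ : L.Structure M) (_ : predLang.Structure M),
          M ⊨ genericTheory.{u, v, w} φ T ∧ (LS L).completeTheory M = T') ∧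
      (∀ (M N : Type (max u v w)) [L.Structure M] [L.Structure N]
        [predLang.Structure M] [predLang.Structure N]
        [M ⊨ genericTheory.{u, v, w} φ T] [N ⊨ genericTheory.{u, v, w} φ T],
        (LS L).completeTheory M = (LS L).completeTheory N ↔
          ∃ f : acl L (∅ : Set M) ≃ acl L (∅ : Set N), IsElementaryLSIso L f)) ∧
    -- (4) algebraic closure in `TS` is algebraic closure in `T`
    (∀ (M : Type (max u v w)) [L.Structure M] [predLang.Structure M]
        [M ⊨ genericTheory.{u, v, w} φ T] (A : Set M),
      acl (LS L) A = acl L A) := by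
  refine ⟨?_, ?_, ⟨?_, ?_, ?_⟩, fun M => hT.acl_LS_eq M⟩
  · intro M N _ _ _ _ _ _ A i j
    rw [hT.equivOver_iff (i := i) (j := j) rfl rfl]
    refine exists_congr fun f => and_congr Iff.rfl ⟨fun h a => h a _ rfl, fun h a x hx => ?_⟩
    rw [← h a]
    exact congrArg (fun x => (f x : N)) (Subtype.ext hx)
  · intro M _ _ _ A ι a b
    have hr : ∀ a : ι → M, Set.range (Sum.elim (fun x : A => (x : M)) a) = A ∪ Set.range a :=
      fun a => by rw [Set.Sum.elim_range, Subtype.range_coe]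
    rw [hT.equivOver_iff (hr a) (hr b)]
    refine exists_congr fun f => and_congr Iff.rfl ⟨fun h => ⟨fun x hx => h (.inl ⟨x, hx⟩) _ rfl,
      fun k => h (.inr k) _ rfl⟩, fun h => ?_⟩
    rintro (x | k) y hy
    · exact (congrArg (fun y => (f y : M)) (Subtype.ext hy)).trans (h.1 x x.2)
    · exact (congrArg (fun y => (f y : M)) (Subtype.ext hy)).trans (h.2 k)
  · intro M _ _ _
    have := nonempty_of_pairTheory φ T M
    exact ⟨completeTheory.isMaximal _ M, Theory.completeTheory.subset⟩
  · intro T' hmax hsub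
    obtain ⟨M, _, _, hM, hMT⟩ := exists_model_completeTheory_eq.{u, v, w} hmax
    exact ⟨M, inferInstance, inferInstance, hM.mono hsub, hMT⟩
  · intro M N _ _ _ _ _ _
    rw [completeTheory_eq_iff_equivOver (α := PEmpty.{max u v w + 1}) PEmpty.elim PEmpty.elim,
      hT.equivOver_iff (Set.range_eq_empty _) (Set.range_eq_empty _)]
    exact exists_congr fun f => and_iff_left fun a => a.elim
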